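/- Let $d\ge 1$ and $\alpha\in(0,2)$. Let $\mu_\alpha = Z_{d,\alpha}^{-1}\,\mathcal F^{-1}\big(e^{-|\xi|^\alpha/\alpha}\big)$ on $\mathbb R^d$, where $\mathcal F g(\xi)=\int e^{-iv\cdot\xi}g(v)\,dv$ and $Z_{d,\alpha}$ is such that $\int\mu_\alpha=1$. Let $L^2_v(\mu_\alpha^{-1})$ be the space of measurable $f:\mathbb R^d\to\mathbb R$ with $\|f\|^2_{L^2_v(\mu_\alpha^{-1})}=\int |f|^2\mu_\alpha^{-1}\,dv<\infty$, let $(\Pi f)(v)=\big(\int f(w)\,dw\big)\mu_\alpha(v)$, and let $$\mathcal S_v(f,f)=\frac{C_{d,\alpha}}2\iint_{\mathbb R^d\times\mathbb R^d}\frac{\big|(f\mu_\alpha^{-1})(v)-(f\mu_\alpha^{-1})(w)\big|^2}{|v-w|^{d+\alpha}}\,\mu_\alpha(v)\,dw\,dv\in[0,\infty],\qquad C_{d,\alpha}=\frac{2^\alpha\Gamma(\frac{d+\alpha}2)}{\pi^{d/2}|\Gamma(-\frac\alpha2)|},$$ with $\mathcal S_v(g,g)=\sum_{i=1}^d\mathcal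 S_v(g_i,g_i)$ for vector fields $g$. For $s\in(0,1)$ let $\|h\|^2_{H^s_v}=\|h\|^2_{L^2_v}+\|(-\Delta)^{s/2}h\|^2_{L^2_v}$, where $(-\Delta)^{s/2}$ is the Fourier multiplier $|\xi|^s$. Call $C>0$ an admissible coercivity constant if $$\|(f-\Pi f)\mu_\alpha^{-1/2}\|^2_{H^{\alpha/2}_v}\le C\,\mathcal S_v(f,f)\qquad\text{for all } f\in L^2_v(\mu_\alpha^{-1}).$$ Then an admissible coercivity constant exists. Moreover, for every admissible coercivity constant $C_F$ and every $\varepsilon>0$ there is a constant $K(\varepsilon)>0$, depending only on $\varepsilon$, $\alpha$, $d$ and $C_F$, such that for every $f\in L^2_v(\mu_\alpha^{-1})$ whose distributional gradient $\nabla_v f$ is a locally integrable function, $$\|\nabla_v f\|^2_{L^2_v(\mu_\alpha^{-1})}\ \le\ K(\varepsilon)\Big(\mathcal S_v(f,f)+\|\Pi f\|^2_{L^2_v(\mu_\alpha^{-1})}\Big)+\varepsilon\,C_F\,\mathcal S_v(\nabla_v f,\nabla_v f),$$ where both sides take values in $[0,\infty]$. -/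

import Mathlib

open MeasureTheory
open scoped ENNReal FourierTransform ContDiff

noncomputable section

namespace LevyFokkerPlanck

/-- Velocity space `ℝ^d` with its Euclidean norm. -/
abbrev Vel (d : ℕ) : Type := EuclideanSpace ℝ (Fin d)

/-- The function `v ↦ (2π)^{-d} ∫ e^{i v·η} e^{-|η|^α/α} dη`, written with the kernel
`e^{2πi v·ξ}` of Mathlib's inverse Fourier transform (substitute `η = 2πξ`).
The integral is real; we take its real part to land in `ℝ`. -/
def stableProfile (d : ℕ) (α : ℝ) (v : Vel d) : ℝ :=
  ((𝓕⁻ (fun ξ : Vel d => ((Real.exp (-(2 * Real.pi * ‖ξ‖) ^ α / α) : ℝ) : ℂ)) : Vel d → ℂ) v).re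

/-- The normalizing constant `Z_{d,α}`. -/
def normalizer (d : ℕ) (α : ℝ) : ℝ := ∫ v, stableProfile d α v

/-- The equilibrium `μ_α`. -/
def equilibrium (d : ℕ) (α : ℝ) (v : Vel d) : ℝ :=
  (normalizer d α)⁻¹ * stableProfile d α v

/-- The measure `μ_α(v)⁻¹ dv`; thus `L²_v(μ_α⁻¹)` is described by `MemLp · 2 (invWeight d α)` and
its norm is `eLpNorm · 2 (invWeight d α)`. -/
def invWeight (d : ℕ) (α : ℝ) : Measure (Vel d) :=
  volume.withDensity (fun v => ENNReal.ofReal (equilibrium d α v)⁻¹)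

/-- The constant `C_{d,α} = 2^α Γ((d+α)/2) / (π^{d/2} |Γ(-α/2)|)` of the fractional Laplacian. -/
def fracLapConst (d : ℕ) (α : ℝ) : ℝ :=
  2 ^ α * Real.Gamma ((d + α) / 2) / (Real.pi ^ ((d : ℝ) / 2) * |Real.Gamma (-α / 2)|)

/-- The diagonal `S_v(f,f)` of the symmetric form, with values in `[0,∞]`:
`S_v(f,f) = (C_{d,α}/2) ∬ |(f/μ_α)(v) - (f/μ_α)(w)|² / |v-w|^{d+α} μ_α(v) dw dv`. -/
def symForm (d : ℕ) (α : ℝ) (f : Vel d → ℝ) : ℝ≥0∞ :=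
  ENNReal.ofReal (fracLapConst d α / 2) *
    ∫⁻ v : Vel d, ∫⁻ w : Vel d, ENNReal.ofReal
      ((f v / equilibrium d α v - f w / equilibrium d α w) ^ 2 / ‖v - w‖ ^ ((d : ℝ) + α)
        * equilibrium d α v)

/-- The value `S_v(g,g) = ∑ᵢ S_v(gᵢ,gᵢ)` on a vector field `g`. -/
def symFormVec (d : ℕ) (α : ℝ) (g : Vel d → Vel d) : ℝ≥0∞ :=
  ∑ i : Fin d, symForm d α (fun v => g v i)

/-- The projection `(Πf)(v) = (∫ f(w) dw) μ_α(v)` onto `ℝ μ_α`. -/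
def proj (d : ℕ) (α : ℝ) (f : Vel d → ℝ) (v : Vel d) : ℝ :=
  (∫ w, f w) * equilibrium d α v

/-- `g` is the distributional gradient of `f`, both locally integrable. -/
def HasWeakGradient {d : ℕ} (f : Vel d → ℝ) (g : Vel d → Vel d) : Prop :=
  LocallyIntegrable f volume ∧ LocallyIntegrable g volume ∧
    ∀ φ : Vel d → ℝ, ContDiff ℝ ∞ φ → HasCompactSupport φ → ∀ i : Fin d,
      ∫ v, f v * fderiv ℝ φ v (EuclideanSpace.single i 1) = -∫ v, g v i * φ v

/-- `‖h‖²_{Ḣ^s} = ‖(-Δ)^{s/2} h‖²_{L²}` for `h ∈ L²`, through Plancherel: `(-Δ)^{s/2}` is the Fourier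
multiplier `|η|^s` for the kernel `e^{-iv·η}`, i.e. `(2π|ξ|)^s` for Mathlib's kernel `e^{-2πiv·ξ}`.
Values in `[0,∞]`. -/
def homSobolevSq {d : ℕ} (s : ℝ) (h : Lp ℂ 2 (volume : Measure (Vel d))) : ℝ≥0∞ :=
  ∫⁻ ξ : Vel d, ENNReal.ofReal ((2 * Real.pi * ‖ξ‖) ^ (2 * s)) *
    ‖(𝓕 h : Lp ℂ 2 (volume : Measure (Vel d))) ξ‖ₑ ^ 2

open Classical in
/-- `‖h‖²_{H^s} = ‖h‖²_{L²} + ‖h‖²_{Ḣ^s}` for a real function `h`; it is `∞` if `h ∉ L²`. -/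
def sobolevSq {d : ℕ} (s : ℝ) (h : Vel d → ℝ) : ℝ≥0∞ :=
  if hh : MemLp (fun v => (h v : ℂ)) 2 (volume : Measure (Vel d)) then
    eLpNorm h 2 volume ^ 2 + homSobolevSq s hh.toLp
  else ∞

/-- `C` is an admissible fractional coercivity constant:
`‖(f - Πf) μ_α^{-1/2}‖²_{H^{α/2}} ≤ C S_v(f,f)` for all `f`. (The form `S_v` takes values
in `[0,∞]`, so that all `f ∈ L²_v(μ_α⁻¹)` can be admitted and not only those in the domain
of the operator.) -/
def IsCoercivityConst (d : ℕ) (α C : ℝ) : Prop :=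
  ∀ f : Vel d → ℝ, MemLp f 2 (invWeight d α) →
    sobolevSq (α / 2) (fun v => (f v - proj d α f v) / √(equilibrium d α v))
      ≤ ENNReal.ofReal C * symForm d α f

end LevyFokkerPlanck

end

/-!
The density `μ_α` is a Gaussian mixture. The function `λ ↦ e^{-λ^{α/2}}` is the Laplace transform of
a one-sided stable law (`exists_stable_subordinator`), so `e^{-|ξ|^α/α}` is a mixture of Gaussians
and `μ_α` is the mixture of the corresponding heat kernels (`stableProfile_eq_gaussMix`). The
behaviour of the Laplace transform near zero then gives the properties of `μ_α` collected in
`IsStableWeight`, on which the rest of the argument depends: `μ_α` has mass one, is comparable to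
`(1 + |v|)^{-(d+α)}` from above and from below, and `|μ_α(v) - μ_α(w)| ≤ L |v - w| μ_α(w)` for
`|v - w| ≤ 1`.

Write `h = f/μ_α`, so that `S_v(f,f)` is a multiple of `dirichletForm (d + α) μ_α h`. Since
`μ_α(v) μ_α(w)` is at most a constant times `(μ_α(v) + μ_α(w)) |v - w|^{-(d+α)}`, the form controls
the variance of `h` under `μ_α`: this is the Poincaré inequality `IsStableWeight.exists_poincare`.

For the coercivity constant, set `k = h - ∫ h μ_α`. The function to be measured in `H^{α/2}` is
`k √μ_α`. Its `L²` norm is the left-hand side of the Poincaré inequality. Its Gagliardo seminorm is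
split, by `k√μ(v) - k√μ(w) = (k(v) - k(w)) √μ(v) + k(w) (√μ(v) - √μ(w))`, into the form of `k` and a
weighted `L²` norm of `k` (`IsStableWeight.exists_gagliardo_le`). The Gagliardo seminorm dominates
the Fourier-side seminorm by Plancherel's identity for translates (`exists_homSobolevSq_le`).

For the gradient estimate, let `u = ∂ᵢf` and let `ρ` be a mollifier at scale `t`. Then
`u = (u - u * ρ) + f * ∂ᵢρ`. The second term is bounded by `f` in the weighted norm. In the first,
`u(v) - u(w)` is the increment of `u/μ_α`, which costs `t^α` times the form of `u`, plus an
increment of `μ_α`, which costs `t²` times the weighted norm of `u` and is absorbed for small `t`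
(`IsStableWeight.exists_gradient_bound`). Absorption needs the norm of `u` to be finite, which
follows from the finiteness of its form. By the Poincaré inequality once more, `f` is controlled by
`S_v(f,f)` and its mass. The prefactor of the form of `u` is arbitrarily small, so the estimate
holds for every positive number in place of `ε C_F`.
-/

namespace LevyFokkerPlanck

open Filter Set Topology

/-! ### The one-sided stable law -/

/-- The Lévy density `s^{-1-β}` integrates `1 - e^{-s}`. -/
lemma integrableOn_one_sub_exp_mul_rpow {β : ℝ} (hβ0 : 0 < β) (hβ1 : β < 1) :
    IntegrableOn (fun s : ℝ => (1 - Real.exp (-s)) * s ^ (-(β + 1))) (Ioi 0) := by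
  have hmeas : Measurable fun s : ℝ => (1 - Real.exp (-s)) * s ^ (-(β + 1)) := by fun_prop
  rw [← Ioc_union_Ioi_eq_Ioi zero_le_one]
  refine IntegrableOn.union ?_ ?_
  · have h : IntegrableOn (fun s : ℝ => s ^ (-β)) (Ioc 0 1) :=
      (intervalIntegrable_iff_integrableOn_Ioc_of_le zero_le_one).1
        (intervalIntegral.intervalIntegrable_rpow' (by linarith))
    refine Integrable.mono' h hmeas.aestronglyMeasurable ?_
    filter_upwards [ae_restrict_mem measurableSet_Ioc] with s hs
    have hs0 : 0 < s := hs.1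
    have h1 : 1 - Real.exp (-s) ≤ s := by linarith [Real.add_one_le_exp (-s)]
    have h2 : 0 ≤ 1 - Real.exp (-s) := by
      have := Real.exp_le_one_iff.2 (by linarith : -s ≤ 0); linarith
    rw [Real.norm_of_nonneg (by positivity)]
    calc (1 - Real.exp (-s)) * s ^ (-(β + 1)) ≤ s * s ^ (-(β + 1)) := by gcongr
      _ = s ^ (-β) := by
        rw [← Real.rpow_one_add' hs0.le (by linarith)]; congr 1; ring
  · have h : IntegrableOn (fun s : ℝ => s ^ (-(β + 1))) (Ioi 1) :=
      integrableOn_Ioi_rpow_of_lt (by linarith) zero_lt_one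
    refine Integrable.mono' h hmeas.aestronglyMeasurable ?_
    filter_upwards [ae_restrict_mem measurableSet_Ioi] with s hs
    have hs0 : 0 < s := zero_lt_one.trans hs
    have h1 : 1 - Real.exp (-s) ≤ 1 := by linarith [Real.exp_pos (-s)]
    have h2 : 0 ≤ 1 - Real.exp (-s) := by
      have := Real.exp_le_one_iff.2 (by linarith : -s ≤ 0); linarith
    rw [Real.norm_of_nonneg (by positivity)]
    exact mul_le_of_le_one_left (by positivity) h1

lemma integral_one_sub_exp_mul_rpow_pos {β : ℝ} (hβ0 : 0 < β) (hβ1 : β < 1) :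
    0 < ∫ s in Ioi (0 : ℝ), (1 - Real.exp (-s)) * s ^ (-(β + 1)) := by
  have hpos : ∀ s ∈ Ioi (0 : ℝ), 0 < (1 - Real.exp (-s)) * s ^ (-(β + 1)) := fun s hs => by
    have hs0 : 0 < s := hs
    have : Real.exp (-s) < 1 := Real.exp_lt_one_iff.2 (by linarith)
    exact mul_pos (by linarith) (by positivity)
  rw [setIntegral_pos_iff_support_of_nonneg_ae _ (integrableOn_one_sub_exp_mul_rpow hβ0 hβ1)]
  · have : Ioi (0 : ℝ) ⊆ Function.support
        (fun s : ℝ => (1 - Real.exp (-s)) * s ^ (-(β + 1))) := fun s hs => (hpos s hs).ne'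
    rw [inter_eq_right.2 this]
    simp
  · filter_upwards [ae_restrict_mem measurableSet_Ioi] with s hs using (hpos s hs).le

/-- Scaling of the Laplace transform of the Pareto law, the source of its stable limit. -/
lemma integral_one_sub_exp_pareto {β a : ℝ} (hβ : 0 < β) (ha : 0 < a) :
    ∫ s, (1 - Real.exp (-(a * s))) ∂(ProbabilityTheory.paretoMeasure 1 β) =
      β * a ^ β * ∫ s in Ioi a, (1 - Real.exp (-s)) * s ^ (-(β + 1)) := by
  rw [ProbabilityTheory.paretoMeasure, show ProbabilityTheory.paretoPDF 1 β =
    fun x => ENNReal.ofReal (ProbabilityTheory.paretoPDFReal 1 β x) from rfl,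
    integral_withDensity_eq_integral_toReal_smul (by fun_prop) (by simp)]
  have h1 : ∀ x, (ENNReal.ofReal (ProbabilityTheory.paretoPDFReal 1 β x)).toReal •
      (1 - Real.exp (-(a * x))) = (Ici (1 : ℝ)).indicator (fun x => β * a ^ (β + 1) *
        ((1 - Real.exp (-(a * x))) * (a * x) ^ (-(β + 1)))) x := by
    intro x
    rw [ENNReal.toReal_ofReal (ProbabilityTheory.paretoPDFReal_nonneg zero_le_one hβ.le x)]
    by_cases hx : 1 ≤ x
    · rw [indicator_of_mem (by exact hx), ProbabilityTheory.paretoPDFReal, if_pos hx,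
        Real.mul_rpow ha.le (by linarith), Real.one_rpow, Real.rpow_neg ha.le, smul_eq_mul]
      have : a ^ (β + 1) ≠ 0 := by positivity
      field_simp
    · rw [indicator_of_notMem (by simpa using hx), ProbabilityTheory.paretoPDFReal, if_neg hx,
        zero_smul]
  rw [integral_congr_ae (Eventually.of_forall h1), integral_indicator measurableSet_Ici,
    integral_Ici_eq_integral_Ioi, integral_const_mul,
    integral_comp_mul_left_Ioi (fun s => (1 - Real.exp (-s)) * s ^ (-(β + 1))) 1 ha,
    mul_one, smul_eq_mul, Real.rpow_add_one ha.ne']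
  field_simp

/-- A pointwise limit of moment functions of laws on `[0,1]` is again such a moment function. -/
lemma exists_probabilityMeasure_of_tendsto_moments (m : ℕ → ProbabilityMeasure unitInterval)
    (φ : ℝ → ℝ) (h : ∀ l, 0 < l →
      Tendsto (fun n => ∫ x, (x : ℝ) ^ l ∂(m n : Measure unitInterval)) atTop (𝓝 (φ l))) :
    ∃ ν : ProbabilityMeasure unitInterval, ∀ l, 0 < l →
      ∫ x, (x : ℝ) ^ l ∂(ν : Measure unitInterval) = φ l := by
  let U : Ultrafilter ℕ := Ultrafilter.of atTop
  have hU : (U : Filter ℕ) ≤ atTop := Ultrafilter.of_le atTop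
  obtain ⟨ν, -, hν⟩ := isCompact_univ.ultrafilter_le_nhds (U.map m) (by simp)
  refine ⟨ν, fun l hl => ?_⟩
  have h1 : Tendsto m U (𝓝 ν) := hν
  rw [ProbabilityMeasure.tendsto_iff_forall_integral_tendsto] at h1
  have hc : Continuous fun x : unitInterval => (x : ℝ) ^ l :=
    continuous_subtype_val.rpow_const fun _ => Or.inr hl.le
  exact tendsto_nhds_unique (h1 (BoundedContinuousFunction.mkOfCompact ⟨_, hc⟩))
    ((h l hl).mono_left hU)

/-- The law on `[0,1]` of `e^{-aS}`, `S` being a sum of `n` independent Pareto variables. -/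
lemma exists_probabilityMeasure_moments_eq_pow {β : ℝ} (hβ0 : 0 < β) (n : ℕ) {a : ℝ}
    (ha : 0 < a) :
    ∃ ν : ProbabilityMeasure unitInterval, ∀ l, 0 < l →
      ∫ x, (x : ℝ) ^ l ∂(ν : Measure unitInterval) =
        (1 - β * (a * l) ^ β *
          ∫ s in Ioi (a * l), (1 - Real.exp (-s)) * s ^ (-(β + 1))) ^ n := by
  have := ProbabilityTheory.isProbabilityMeasure_paretoMeasure zero_lt_one hβ0
  set P := ProbabilityTheory.paretoMeasure 1 β
  have hm : Measurable fun s : Fin n → ℝ =>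
      ∏ i, projIcc (0 : ℝ) 1 zero_le_one (Real.exp (-(a * s i))) := by
    refine Finset.measurable_fun_prod _ fun i _ => ?_
    exact continuous_projIcc.measurable.comp (by fun_prop)
  refine ⟨⟨(Measure.pi fun _ : Fin n => P).map _, Measure.isProbabilityMeasure_map hm.aemeasurable⟩,
    fun l hl => ?_⟩
  have hc : Continuous fun x : unitInterval => (x : ℝ) ^ l :=
    continuous_subtype_val.rpow_const fun _ => Or.inr hl.le
  rw [ProbabilityMeasure.coe_mk, integral_map hm.aemeasurable hc.aestronglyMeasurable]
  have h1 : ∀ s : Fin n → ℝ,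
      ((∏ i, projIcc (0 : ℝ) 1 zero_le_one (Real.exp (-(a * s i))) : unitInterval) : ℝ) ^ l =
      ∏ i, (fun s : ℝ => (projIcc (0 : ℝ) 1 zero_le_one (Real.exp (-(a * s))) : ℝ) ^ l) (s i) := by
    intro s
    rw [Real.finsetProd_rpow _ _ fun i _ => (projIcc _ _ _ _).2.1]
    congr 1
    exact map_prod (unitInterval.submonoid.subtype) _ _
  rw [integral_congr_ae (Eventually.of_forall h1),
    integral_fintype_prod_eq_pow (ι := Fin n) (μ := P)
      (fun s : ℝ => (projIcc (0 : ℝ) 1 zero_le_one (Real.exp (-(a * s))) : ℝ) ^ l),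
    Fintype.card_fin]
  congr 1
  have hpos : ∀ᵐ s ∂P, 0 ≤ s := by
    rw [ae_iff]
    have : {s : ℝ | ¬ 0 ≤ s} = Iio 0 := by ext; simp
    rw [this, show P = volume.withDensity (ProbabilityTheory.paretoPDF 1 β) from rfl,
      withDensity_apply _ measurableSet_Iio]
    exact ProbabilityTheory.lintegral_paretoPDF_of_le zero_le_one
  have hI : Integrable (fun s => Real.exp (-(a * l * s))) P := by
    refine Integrable.of_bound (by fun_prop) 1 ?_
    filter_upwards [hpos] with s hs
    rw [Real.norm_of_nonneg (Real.exp_pos _).le]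
    exact Real.exp_le_one_iff.2 (by have := mul_pos ha hl; nlinarith)
  rw [← integral_one_sub_exp_pareto hβ0 (mul_pos ha hl), integral_sub (integrable_const _) hI]
  simp only [integral_const, probReal_univ, smul_eq_mul, mul_one, sub_sub_cancel]
  refine integral_congr_ae ?_
  filter_upwards [hpos] with s hs
  rw [projIcc_of_mem zero_le_one ⟨(Real.exp_pos _).le, Real.exp_le_one_iff.2 (by nlinarith)⟩]
  simp only
  rw [← Real.exp_mul]
  congr 1; ring

/-- Existence of the one-sided stable law: `λ ↦ e^{-κ λ^β}` is the Laplace transform of a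
probability measure on `(0,∞)`. It is the limit law of scaled sums of Pareto variables. The
substitution `x = e^{-s}` turns Laplace transforms into moments of laws on `[0,1]`, where
compactness is free; what remains is that the limit has no atom at either endpoint. -/
theorem exists_stable_subordinator {β κ : ℝ} (hβ0 : 0 < β) (hβ1 : β < 1) (hκ : 0 < κ) :
    ∃ η : Measure ℝ, IsProbabilityMeasure η ∧ η (Iic 0) = 0 ∧
      ∀ l, 0 < l → ∫ s, Real.exp (-(l * s)) ∂η = Real.exp (-(κ * l ^ β)) := by
  set W := ∫ s in Ioi (0 : ℝ), (1 - Real.exp (-s)) * s ^ (-(β + 1)) with hW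
  have hW0 : 0 < W := integral_one_sub_exp_mul_rpow_pos hβ0 hβ1
  -- the scale for which `(n + 1) β (a n l)^β W = κ l^β`
  let a : ℕ → ℝ := fun n => (κ / (β * W) / (n + 1)) ^ β⁻¹
  have ha : ∀ n, 0 < a n := fun n => by positivity
  have haβ : ∀ n, a n ^ β = κ / (β * W) / (n + 1) := fun n =>
    Real.rpow_inv_rpow (by positivity) hβ0.ne'
  have ha0 : Tendsto a atTop (𝓝 0) := by
    have h1 : Tendsto (fun n : ℕ => κ / (β * W) / ((n : ℝ) + 1)) atTop (𝓝 0) :=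
      tendsto_const_nhds.div_atTop (tendsto_atTop_add_const_right _ _ tendsto_natCast_atTop_atTop)
    have := h1.rpow_const (p := β⁻¹) (Or.inr (by positivity))
    rwa [Real.zero_rpow (by positivity)] at this
  choose m hm using fun n => exists_probabilityMeasure_moments_eq_pow hβ0 (n + 1) (ha n)
  obtain ⟨ν, hν⟩ := exists_probabilityMeasure_of_tendsto_moments m
    (fun l => Real.exp (-(κ * l ^ β))) (fun l hl => by
      simp_rw [hm _ l hl]
      -- the moments are `(1 + g (n + 1)) ^ (n + 1)`, shifted to match the limit formula
      let g : ℕ → ℝ := fun n => - (κ / (β * W) / n * l ^ β * β *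
        ∫ s in Ioi (a (n - 1) * l), (1 - Real.exp (-s)) * s ^ (-(β + 1)))
      have hg : Tendsto (fun n : ℕ => n * g n) atTop (𝓝 (-(κ * l ^ β))) := by
        have h1 : Tendsto (fun n : ℕ => ∫ s in Ioi (a n * l),
            (1 - Real.exp (-s)) * s ^ (-(β + 1))) atTop (𝓝 W) := by
          have hal : Tendsto (fun n => a n * l) atTop (𝓝 0) := by simpa using ha0.mul_const l
          have := (aecover_Ioi_of_Ioi (μ := volume) (A := 0)
            hal).integral_tendsto_of_countably_generated
            (integrableOn_one_sub_exp_mul_rpow hβ0 hβ1)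
          refine this.congr fun n => ?_
          rw [Measure.restrict_restrict measurableSet_Ioi, inter_eq_left.2]
          exact Ioi_subset_Ioi (mul_pos (ha n) hl).le
        rw [← tendsto_add_atTop_iff_nat 1]
        have h2 := (h1.const_mul (κ / (β * W) * l ^ β * β)).neg
        have e : -(κ / (β * W) * l ^ β * β * W) = -(κ * l ^ β) := by field_simp
        rw [e] at h2
        refine h2.congr fun n => ?_
        simp only [g, Nat.add_sub_cancel]
        push_cast
        field_simp
      have := Real.tendsto_one_add_pow_exp_of_tendsto hg
      rw [← tendsto_add_atTop_iff_nat 1] at this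
      refine this.congr fun n => ?_
      simp only [g, Nat.add_sub_cancel]
      rw [Real.mul_rpow (ha n).le hl.le, haβ]
      push_cast
      congr 1
      ring)
  have hint : ∀ l : ℝ, 0 < l → Integrable (fun x : unitInterval => (x : ℝ) ^ l)
      (ν : Measure unitInterval) := fun l hl => by
    have hc : Continuous fun x : unitInterval => (x : ℝ) ^ l :=
      continuous_subtype_val.rpow_const fun _ => Or.inr hl.le
    exact (BoundedContinuousFunction.mkOfCompact ⟨_, hc⟩).integrable _
  have hlim0 : Tendsto (fun n : ℕ => ((n : ℝ) + 1)⁻¹) atTop (𝓝 0) :=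
    tendsto_inv_atTop_zero.comp
      (tendsto_atTop_add_const_right _ _ tendsto_natCast_atTop_atTop)
  -- no atom at `0`: let the exponent tend to `0`
  have hν0 : (ν : Measure unitInterval).real {0} = 0 := by
    have h1 : ∀ l, 0 < l → Real.exp (-(κ * l ^ β)) ≤ (ν : Measure unitInterval).real {0}ᶜ := by
      intro l hl
      rw [← hν l hl, ← integral_indicator_one (measurableSet_singleton 0).compl]
      refine integral_mono (hint l hl) ((integrable_const _).indicator
        (measurableSet_singleton 0).compl) fun x => ?_
      by_cases hx : x = 0
      · simp [hx, Real.zero_rpow hl.ne']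
      · simp only [indicator_of_mem (show x ∈ ({0}ᶜ : Set unitInterval) from hx), Pi.one_apply]
        exact Real.rpow_le_one x.2.1 x.2.2 hl.le
    have h2 : 1 ≤ (ν : Measure unitInterval).real {0}ᶜ := by
      have h3 : Tendsto (fun n : ℕ => Real.exp (-(κ * ((n : ℝ) + 1)⁻¹ ^ β))) atTop (𝓝 1) := by
        have := ((hlim0.rpow_const (p := β) (Or.inr hβ0.le)).const_mul κ).neg
        rw [Real.zero_rpow hβ0.ne', mul_zero, neg_zero] at this
        have h4 := (Real.continuous_exp.tendsto 0).comp this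
        rwa [Real.exp_zero] at h4
      exact le_of_tendsto h3 (Eventually.of_forall fun n => h1 _ (by positivity))
    rw [probReal_compl_eq_one_sub (measurableSet_singleton 0)] at h2
    linarith [measureReal_nonneg (μ := (ν : Measure unitInterval)) (s := {0})]
  -- no atom at `1`: let the exponent tend to `∞`
  have hν1 : (ν : Measure unitInterval).real {1} = 0 := by
    have h1 : ∀ l, 0 < l → (ν : Measure unitInterval).real {1} ≤ Real.exp (-(κ * l ^ β)) := by
      intro l hl
      rw [← hν l hl, ← integral_indicator_one (measurableSet_singleton 1)]
      refine integral_mono ((integrable_const _).indicator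
        (measurableSet_singleton 1)) (hint l hl) fun x => ?_
      by_cases hx : x = 1
      · simp [hx]
      · simp only [indicator_of_notMem (show x ∉ ({1} : Set unitInterval) from hx)]
        exact Real.rpow_nonneg x.2.1 _
    have h3 : Tendsto (fun n : ℕ => Real.exp (-(κ * ((n : ℝ) + 1) ^ β))) atTop (𝓝 0) :=
      Real.tendsto_exp_neg_atTop_nhds_zero.comp (Tendsto.const_mul_atTop hκ
        ((tendsto_rpow_atTop hβ0).comp
          (tendsto_atTop_add_const_right _ _ tendsto_natCast_atTop_atTop)))
    exact le_antisymm (ge_of_tendsto h3 (Eventually.of_forall fun n => h1 _ (by positivity)))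
      measureReal_nonneg
  have hmeas : Measurable fun x : unitInterval => -Real.log x :=
    (Real.measurable_log.comp measurable_subtype_coe).neg
  refine ⟨(ν : Measure unitInterval).map fun x : unitInterval => -Real.log x,
    Measure.isProbabilityMeasure_map hmeas.aemeasurable, ?_, fun l hl => ?_⟩
  · rw [Measure.map_apply hmeas measurableSet_Iic]
    refine measure_mono_null (t := {0} ∪ {1}) (fun x hx => ?_) ?_
    · by_contra hne
      simp only [singleton_union, mem_insert_iff, mem_singleton_iff, not_or] at hne
      have h0 : 0 < (x : ℝ) := lt_of_le_of_ne x.2.1 (fun h => hne.1 (Subtype.ext h.symm))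
      have h1 : (x : ℝ) < 1 := lt_of_le_of_ne x.2.2 (fun h => hne.2 (Subtype.ext h))
      have := Real.log_neg h0 h1
      simp only [mem_preimage, mem_Iic] at hx
      linarith
    · exact measure_union_null ((measureReal_eq_zero_iff).1 hν0) ((measureReal_eq_zero_iff).1 hν1)
  · rw [integral_map hmeas.aemeasurable (by fun_prop), ← hν l hl]
    refine integral_congr_ae ?_
    have : ∀ᵐ x ∂(ν : Measure unitInterval), x ≠ 0 :=
      measure_mono_null (by intro x; simp) ((measureReal_eq_zero_iff).1 hν0)
    filter_upwards [this] with x hx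
    have h0 : 0 < (x : ℝ) := lt_of_le_of_ne x.2.1 (fun h => hx (Subtype.ext h.symm))
    rw [Real.rpow_def_of_pos h0]
    congr 1; ring

/-! ### Two-sided bounds for Gaussian mixtures along a stable subordinator -/

/-- `η` is the law of the stable subordinator at a fixed time: a probability measure carried by
`(0,∞)` with Laplace transform `e^{-κ λ^β}`. -/
structure IsStableSubordinator (β κ : ℝ) (η : Measure ℝ) : Prop where
  isProb : IsProbabilityMeasure η
  null : η (Iic 0) = 0
  laplace : ∀ l, 0 < l → ∫ s, Real.exp (-(l * s)) ∂η = Real.exp (-(κ * l ^ β))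

/-- The radial profile `r ↦ ∫ s^{-k} e^{-c r²/s} dη(s)` of a mixture of Gaussians. -/
noncomputable def gaussMix (η : Measure ℝ) (k c r : ℝ) : ℝ :=
  ∫ s, s ^ (-k) * Real.exp (-(c * r ^ 2 / s)) ∂η

lemma div_one_add_le_one_sub_exp {x : ℝ} (hx : 0 ≤ x) : x / (1 + x) ≤ 1 - Real.exp (-x) := by
  have h1 : Real.exp (-x) ≤ (1 + x)⁻¹ := by
    rw [Real.exp_neg]
    exact inv_anti₀ (by linarith) (by linarith [Real.add_one_le_exp x])
  have h2 : x / (1 + x) = 1 - (1 + x)⁻¹ := by field_simp; ring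
  linarith

lemma one_sub_exp_le {x : ℝ} : 1 - Real.exp (-x) ≤ x := by
  linarith [Real.add_one_le_exp (-x)]

/-- Exponentials beat powers, in the form `u^m e^{-cu} ≤ (m/c)^m`. -/
lemma rpow_mul_exp_neg_le {m c u : ℝ} (hm : 0 < m) (hc : 0 < c) (hu : 0 ≤ u) :
    u ^ m * Real.exp (-(c * u)) ≤ (m / c) ^ m := by
  have h1 : c * u / m ≤ Real.exp (c * u / m) := by linarith [Real.add_one_le_exp (c * u / m)]
  have h2 : (c * u / m) ^ m ≤ Real.exp (c * u) := by
    calc (c * u / m) ^ m ≤ Real.exp (c * u / m) ^ m := by gcongr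
      _ = Real.exp (c * u) := by rw [← Real.exp_mul]; congr 1; field_simp
  have h3 : u ^ m = (c * u / m) ^ m * (m / c) ^ m := by
    rw [← Real.mul_rpow (by positivity) (by positivity)]; congr 1; field_simp
  rw [h3, Real.exp_neg]
  calc (c * u / m) ^ m * (m / c) ^ m * (Real.exp (c * u))⁻¹
      ≤ Real.exp (c * u) * (m / c) ^ m * (Real.exp (c * u))⁻¹ := by gcongr
    _ = (m / c) ^ m := by field_simp

/-- The comparison `t^{-k} e^{-c/t} ≲ 1 - e^{-t}`, which turns a bound on the Laplace transform
of a measure into a bound on its Gaussian mixture. -/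
lemma exists_rpow_neg_mul_exp_le {k c : ℝ} (hk : 0 < k) (hc : 0 < c) :
    ∃ C, 0 < C ∧ ∀ t, 0 < t → t ^ (-k) * Real.exp (-(c / t)) ≤ C * (1 - Real.exp (-t)) := by
  refine ⟨(k / c) ^ k + ((k + 1) / c) ^ (k + 1), by positivity, fun t ht => ?_⟩
  have h1 := div_one_add_le_one_sub_exp ht.le
  have hu : 0 < t⁻¹ := by positivity
  have e1 := rpow_mul_exp_neg_le hk hc hu.le
  have e2 := rpow_mul_exp_neg_le (by linarith : 0 < k + 1) hc hu.le
  have key : t ^ (-k) * Real.exp (-(c / t)) =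
      ((t⁻¹) ^ k * Real.exp (-(c * t⁻¹)) + (t⁻¹) ^ (k + 1) * Real.exp (-(c * t⁻¹))) *
        (t / (1 + t)) := by
    rw [Real.rpow_add_one hu.ne', Real.rpow_neg ht.le, Real.inv_rpow ht.le, ← div_eq_mul_inv c t]
    have : 0 < t ^ k := by positivity
    field_simp
    ring
  rw [key]
  gcongr

namespace IsStableSubordinator

variable {β κ : ℝ} {η : Measure ℝ}

lemma ae_pos (h : IsStableSubordinator β κ η) : ∀ᵐ s ∂η, 0 < s := by
  rw [ae_iff]
  simpa [Iic] using h.null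

lemma integrable_exp_neg (h : IsStableSubordinator β κ η) {l : ℝ} (hl : 0 ≤ l) :
    Integrable (fun s => Real.exp (-(l * s))) η := by
  have := h.isProb
  refine Integrable.of_bound (by fun_prop) 1 ?_
  filter_upwards [h.ae_pos] with s hs
  rw [Real.norm_of_nonneg (Real.exp_pos _).le]
  exact Real.exp_le_one_iff.2 (by nlinarith)

lemma integral_one_sub_exp (h : IsStableSubordinator β κ η) {l : ℝ} (hl : 0 < l) :
    ∫ s, (1 - Real.exp (-(l * s))) ∂η = 1 - Real.exp (-(κ * l ^ β)) := by
  have := h.isProb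
  rw [integral_sub (integrable_const _) (h.integrable_exp_neg hl.le), h.laplace l hl]
  simp

/-- All negative moments are finite: `Γ(k) s^{-k} = ∫ λ^{k-1} e^{-λ s} dλ`, and the Laplace
transform decays faster than any power. -/
lemma integrable_rpow_neg (h : IsStableSubordinator β κ η) (hβ : 0 < β) (hκ : 0 < κ) {k : ℝ}
    (hk : 0 < k) : Integrable (fun s => s ^ (-k)) η := by
  have := h.isProb
  have hI : Integrable (fun p : ℝ × ℝ => p.1 ^ (k - 1) * Real.exp (-(p.1 * p.2)))
      ((volume.restrict (Ioi 0)).prod η) := by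
    rw [integrable_prod_iff (Measurable.aestronglyMeasurable (by fun_prop))]
    constructor
    · filter_upwards [ae_restrict_mem measurableSet_Ioi] with l hl
      exact (h.integrable_exp_neg (le_of_lt hl)).const_mul _
    · refine (integrableOn_rpow_mul_exp_neg_mul_rpow (s := k - 1) (by linarith) hβ hκ).congr ?_
      filter_upwards [ae_restrict_mem measurableSet_Ioi] with l hl
      have hl0 : 0 < l := hl
      simp_rw [norm_mul, Real.norm_of_nonneg (Real.exp_pos _).le,
        Real.norm_of_nonneg (Real.rpow_nonneg hl0.le _)]
      rw [integral_const_mul, h.laplace l hl0, neg_mul]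
  have h2 := (hI.integral_prod_right).const_mul (Real.Gamma k)⁻¹
  refine h2.congr ?_
  filter_upwards [h.ae_pos] with s hs
  have := Real.integral_rpow_mul_exp_neg_mul_Ioi hk hs
  simp_rw [mul_comm s] at this
  rw [this, one_div, Real.inv_rpow hs.le, Real.rpow_neg hs.le]
  have := (Real.Gamma_pos_of_pos hk).ne'
  field_simp

lemma integrable_gaussMix (h : IsStableSubordinator β κ η) (hβ : 0 < β) (hκ : 0 < κ) {k c : ℝ}
    (hk : 0 < k) (hc : 0 ≤ c) (r : ℝ) :
    Integrable (fun s => s ^ (-k) * Real.exp (-(c * r ^ 2 / s))) η := by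
  refine (h.integrable_rpow_neg hβ hκ hk).mono'
    (Measurable.aestronglyMeasurable (by fun_prop)) ?_
  filter_upwards [h.ae_pos] with s hs
  rw [Real.norm_of_nonneg (by positivity)]
  exact mul_le_of_le_one_right (by positivity)
    (Real.exp_le_one_iff.2 (neg_nonpos.2 (by positivity)))

lemma gaussMix_nonneg (h : IsStableSubordinator β κ η) (k c r : ℝ) : 0 ≤ gaussMix η k c r := by
  refine integral_nonneg_of_ae ?_
  filter_upwards [h.ae_pos] with s hs
  positivity

lemma gaussMix_antitone (h : IsStableSubordinator β κ η) (hβ : 0 < β) (hκ : 0 < κ) {k c : ℝ}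
    (hk : 0 < k) (hc : 0 ≤ c) {r r' : ℝ} (hr : 0 ≤ r) (hrr : r ≤ r') :
    gaussMix η k c r' ≤ gaussMix η k c r := by
  refine integral_mono_ae (h.integrable_gaussMix hβ hκ hk hc _)
    (h.integrable_gaussMix hβ hκ hk hc _) ?_
  filter_upwards [h.ae_pos] with s hs
  gcongr

/-- The tail bound: compare the integrand with `1 - e^{-s/r²}`, whose integral is `O(r^{-2β})`. -/
lemma gaussMix_le_rpow (h : IsStableSubordinator β κ η) (hβ : 0 < β) (hκ : 0 < κ) {k c : ℝ}
    (hk : 0 < k) (hc : 0 < c) :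
    ∃ C, 0 < C ∧ ∀ r, 0 < r → gaussMix η k c r ≤ C * r ^ (-(2 * k + 2 * β)) := by
  have := h.isProb
  obtain ⟨C, hC, hle⟩ := exists_rpow_neg_mul_exp_le hk hc
  refine ⟨C * κ, by positivity, fun r hr => ?_⟩
  have hl : 0 < (r ^ 2)⁻¹ := by positivity
  calc gaussMix η k c r ≤ ∫ s, (r ^ 2) ^ (-k) * (C * (1 - Real.exp (-((r ^ 2)⁻¹ * s)))) ∂η := by
        refine integral_mono_ae (h.integrable_gaussMix hβ hκ hk hc.le _)
          ((((integrable_const _).sub (h.integrable_exp_neg hl.le)).const_mul _).const_mul _) ?_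
        filter_upwards [h.ae_pos] with s hs
        have e := hle ((r ^ 2)⁻¹ * s) (by positivity)
        have e2 : s ^ (-k) = (r ^ 2) ^ (-k) * ((r ^ 2)⁻¹ * s) ^ (-k) := by
          rw [← Real.mul_rpow (by positivity) (by positivity)]; congr 1; field_simp
        have e3 : c * r ^ 2 / s = c / ((r ^ 2)⁻¹ * s) := by field_simp
        rw [e2, e3, mul_assoc]
        gcongr
    _ = (r ^ 2) ^ (-k) * (C * (1 - Real.exp (-(κ * ((r ^ 2)⁻¹) ^ β)))) := by
        rw [integral_const_mul, integral_const_mul, h.integral_one_sub_exp hl]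
    _ ≤ (r ^ 2) ^ (-k) * (C * (κ * ((r ^ 2)⁻¹) ^ β)) := by
        gcongr
        exact one_sub_exp_le
    _ = C * κ * r ^ (-(2 * k + 2 * β)) := by
        rw [Real.inv_rpow (by positivity), ← Real.rpow_neg (by positivity), ← Real.rpow_natCast,
          ← Real.rpow_mul hr.le, ← Real.rpow_mul hr.le,
          show -(2 * k + 2 * β) = ((2 : ℕ) : ℝ) * -k + ((2 : ℕ) : ℝ) * -β by push_cast; ring,
          Real.rpow_add hr]
        ring

/-- Upper bound for Gaussian mixtures, with the polynomial tail of the stable law. -/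
theorem gaussMix_le (h : IsStableSubordinator β κ η) (hβ : 0 < β) (hκ : 0 < κ) {k c : ℝ}
    (hk : 0 < k) (hc : 0 < c) :
    ∃ C, 0 < C ∧ ∀ r, 0 ≤ r → gaussMix η k c r ≤ C * (1 + r) ^ (-(2 * k + 2 * β)) := by
  obtain ⟨C, hC, hle⟩ := h.gaussMix_le_rpow hβ hκ hk hc
  set N := 2 * k + 2 * β
  have hN : 0 < N := by positivity
  set C0 := gaussMix η k c 0
  have hC0 : 0 ≤ C0 := h.gaussMix_nonneg _ _ _
  refine ⟨(C + C0) * 2 ^ N, by positivity, fun r hr => ?_⟩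
  rcases le_total r 1 with h1 | h1
  · have e : (1 : ℝ) ≤ 2 ^ N * (1 + r) ^ (-N) := by
      rw [Real.rpow_neg (by positivity), ← div_eq_mul_inv, one_le_div (by positivity)]
      gcongr; linarith
    calc gaussMix η k c r ≤ C0 := h.gaussMix_antitone hβ hκ hk hc.le le_rfl hr
      _ ≤ (C + C0) * (2 ^ N * (1 + r) ^ (-N)) := by nlinarith
      _ = _ := by ring
  · have hr0 : 0 < r := by linarith
    have e : r ^ (-N) ≤ 2 ^ N * (1 + r) ^ (-N) := by
      have : r ^ (-N) = 2 ^ N * (2 * r) ^ (-N) := by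
        rw [Real.mul_rpow (by positivity) hr, Real.rpow_neg (by positivity : (0 : ℝ) ≤ 2)]
        have : (0 : ℝ) < 2 ^ N := by positivity
        field_simp
      rw [this]
      gcongr ?_ * ?_
      exact Real.rpow_le_rpow_of_nonpos (by positivity) (by linarith) (by linarith)
    calc gaussMix η k c r ≤ C * r ^ (-N) := hle r hr0
      _ ≤ (C + C0) * (2 ^ N * (1 + r) ^ (-N)) := by
        gcongr; linarith
      _ = _ := by ring

/-- A dyadic-type block `[δR, MR]` carries a mass of order `R^{-β}`. Together with the two
remaining pieces, which are controlled by the Laplace transform at `1/(δR)` and `1/(MR)`, it must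
make up for the whole of `∫ (1 - e^{-s/R}) dη ≈ R^{-β}`. -/
lemma exists_le_measureReal_Icc (h : IsStableSubordinator β κ η) (hβ0 : 0 < β) (hβ1 : β < 1)
    (hκ : 0 < κ) : ∃ δ M c, 0 < δ ∧ 0 < M ∧ 0 < c ∧
      ∀ R, 1 ≤ R → c * R ^ (-β) ≤ η.real (Icc (δ * R) (M * R)) := by
  have := h.isProb
  -- `q` is small enough for each remaining piece to be at most a quarter of the whole integral
  set q : ℝ := (8 * (1 + κ))⁻¹ with hq
  have hq0 : 0 < q := by positivity
  set δ := q ^ (1 - β)⁻¹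
  set M := q ^ (-β⁻¹)
  have hδ : 0 < δ := by positivity
  have hM : 0 < M := by positivity
  have hδq : δ * δ ^ (-β) = q := by
    rw [← Real.rpow_one_add' hδ.le (by linarith), ← sub_eq_add_neg,
      Real.rpow_inv_rpow hq0.le (by linarith)]
  have hMq : M ^ (-β) = q := by
    rw [← Real.rpow_mul hq0.le, neg_mul_neg, inv_mul_cancel₀ hβ0.ne', Real.rpow_one]
  refine ⟨δ, M, κ * (4 * q), hδ, hM, by positivity, fun R hR => ?_⟩
  have hR0 : 0 < R := by linarith
  have key : ∀ s, 0 < s → 1 - Real.exp (-(R⁻¹ * s)) ≤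
      (Icc (δ * R) (M * R)).indicator 1 s + (2 * δ * (1 - Real.exp (-((δ * R)⁻¹ * s))) +
        2 * (1 - Real.exp (-((M * R)⁻¹ * s)))) := by
    intro s hs
    have pos : ∀ l : ℝ, 0 < l → 0 ≤ 1 - Real.exp (-(l * s)) := fun l hl => by
      linarith [Real.exp_le_one_iff.2 (neg_nonpos.2 (by positivity : 0 ≤ l * s))]
    have p1 := pos (δ * R)⁻¹ (by positivity)
    have p2 := pos (M * R)⁻¹ (by positivity)
    have p3 : 0 ≤ 2 * δ * (1 - Real.exp (-((δ * R)⁻¹ * s))) := by positivity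
    by_cases h1 : s ∈ Icc (δ * R) (M * R)
    · rw [indicator_of_mem h1, Pi.one_apply]
      linarith [Real.exp_pos (-(R⁻¹ * s))]
    · rw [indicator_of_notMem h1]
      rcases not_and_or.1 h1 with h2 | h2
      · have hx : (δ * R)⁻¹ * s ≤ 1 := by
          rw [inv_mul_le_one₀ (by positivity)]; linarith
        have e1 := div_one_add_le_one_sub_exp (x := (δ * R)⁻¹ * s) (by positivity)
        have e2 : (δ * R)⁻¹ * s / 2 ≤ (δ * R)⁻¹ * s / (1 + (δ * R)⁻¹ * s) := by
          gcongr; linarith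
        have e3 : R⁻¹ * s = 2 * δ * ((δ * R)⁻¹ * s / 2) := by field_simp
        have e4 : R⁻¹ * s ≤ 2 * δ * (1 - Real.exp (-((δ * R)⁻¹ * s))) := by
          rw [e3]; gcongr; linarith
        linarith [one_sub_exp_le (x := R⁻¹ * s)]
      · have hx : 1 ≤ (M * R)⁻¹ * s := by
          rw [← div_eq_inv_mul, one_le_div (by positivity)]; linarith
        have e1 := div_one_add_le_one_sub_exp (x := (M * R)⁻¹ * s) (by positivity)
        have e2 : 1 / 2 ≤ (M * R)⁻¹ * s / (1 + (M * R)⁻¹ * s) := by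
          rw [div_le_div_iff₀ (by norm_num) (by positivity)]; linarith
        linarith [Real.exp_pos (-(R⁻¹ * s))]
  have hint : ∀ l : ℝ, 0 < l → Integrable (fun s => 1 - Real.exp (-(l * s))) η := fun l hl =>
    (integrable_const _).sub (h.integrable_exp_neg hl.le)
  have hi1 := (hint (δ * R)⁻¹ (by positivity)).const_mul (2 * δ)
  have hi2 := (hint (M * R)⁻¹ (by positivity)).const_mul 2
  have hi12 : Integrable (fun s => 2 * δ * (1 - Real.exp (-((δ * R)⁻¹ * s))) +
      2 * (1 - Real.exp (-((M * R)⁻¹ * s)))) η := hi1.add hi2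
  have hi3 : Integrable ((Icc (δ * R) (M * R)).indicator (1 : ℝ → ℝ)) η :=
    (integrable_const _).indicator measurableSet_Icc
  have hint2 := integral_mono_ae (hint R⁻¹ (by positivity)) (hi3.add hi12)
    (by filter_upwards [h.ae_pos] with s hs using key s hs)
  simp only [Pi.add_apply] at hint2
  rw [integral_add hi3 hi12, integral_indicator_one measurableSet_Icc, integral_add hi1 hi2,
    integral_const_mul, integral_const_mul, h.integral_one_sub_exp (by positivity),
    h.integral_one_sub_exp (by positivity), h.integral_one_sub_exp (by positivity)] at hint2
  have hinv : ∀ a : ℝ, 0 < a → ((a * R)⁻¹) ^ β = a ^ (-β) * R ^ (-β) := fun a ha => by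
    rw [Real.inv_rpow (by positivity), ← Real.rpow_neg (by positivity),
      Real.mul_rpow ha.le hR0.le]
  have hinvR : (R⁻¹) ^ β = R ^ (-β) := by
    rw [Real.inv_rpow hR0.le, ← Real.rpow_neg hR0.le]
  rw [hinvR] at hint2
  have u1 := one_sub_exp_le (x := κ * ((δ * R)⁻¹) ^ β)
  have u2 := one_sub_exp_le (x := κ * ((M * R)⁻¹) ^ β)
  have hRβ : R ^ (-β) ≤ 1 := Real.rpow_le_one_of_one_le_of_nonpos hR (by linarith)
  have hRβ0 : 0 < R ^ (-β) := by positivity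
  have u3 := div_one_add_le_one_sub_exp (x := κ * R ^ (-β)) (by positivity)
  have u4 : κ * R ^ (-β) * (8 * q) ≤ κ * R ^ (-β) / (1 + κ * R ^ (-β)) := by
    have : 8 * q = (1 + κ)⁻¹ := by rw [hq]; field_simp
    rw [this, ← div_eq_mul_inv]
    gcongr
    nlinarith
  have u5 : 2 * δ * (1 - Real.exp (-(κ * ((δ * R)⁻¹) ^ β))) ≤ 2 * (κ * R ^ (-β)) * q := by
    calc _ ≤ 2 * δ * (κ * ((δ * R)⁻¹) ^ β) := by gcongr
      _ = 2 * (κ * R ^ (-β)) * (δ * δ ^ (-β)) := by rw [hinv δ hδ]; ring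
      _ = _ := by rw [hδq]
  have u6 : 2 * (1 - Real.exp (-(κ * ((M * R)⁻¹) ^ β))) ≤ 2 * (κ * R ^ (-β)) * q := by
    calc _ ≤ 2 * (κ * ((M * R)⁻¹) ^ β) := by gcongr
      _ = 2 * (κ * R ^ (-β)) * (M ^ (-β)) := by rw [hinv M hM]; ring
      _ = _ := by rw [hMq]
  nlinarith

/-- Lower bound for Gaussian mixtures, matching `gaussMix_le`. -/
theorem le_gaussMix (h : IsStableSubordinator β κ η) (hβ0 : 0 < β) (hβ1 : β < 1) (hκ : 0 < κ)
    {k c : ℝ} (hk : 0 < k) (hc : 0 < c) :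
    ∃ C, 0 < C ∧ ∀ r, 0 ≤ r → C * (1 + r) ^ (-(2 * k + 2 * β)) ≤ gaussMix η k c r := by
  have := h.isProb
  obtain ⟨δ, M, a, hδ, hM, ha, hle⟩ := h.exists_le_measureReal_Icc hβ0 hβ1 hκ
  set A := M ^ (-k) * Real.exp (-(c / δ)) * a with hA
  have hA0 : 0 < A := by positivity
  set N := 2 * k + 2 * β with hN
  have hN0 : 0 < N := by positivity
  have main : ∀ r, 1 ≤ r → A * r ^ (-N) ≤ gaussMix η k c r := by
    intro r hr
    have hr0 : 0 < r := by linarith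
    have e1 : r ^ (-N) = (r ^ 2) ^ (-k) * (r ^ 2) ^ (-β) := by
      rw [← Real.rpow_natCast, ← Real.rpow_mul hr0.le, ← Real.rpow_mul hr0.le, ← Real.rpow_add hr0]
      congr 1; push_cast; ring
    -- keep only the part of the mixture carried by the block at scale `r²`
    calc A * r ^ (-N) = ((M * r ^ 2) ^ (-k) * Real.exp (-(c / δ))) * (a * (r ^ 2) ^ (-β)) := by
          rw [e1, hA, Real.mul_rpow hM.le (by positivity)]; ring
      _ ≤ ((M * r ^ 2) ^ (-k) * Real.exp (-(c / δ))) *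
            η.real (Icc (δ * r ^ 2) (M * r ^ 2)) := by
          gcongr
          exact hle _ (by nlinarith)
      _ = ∫ s, (Icc (δ * r ^ 2) (M * r ^ 2)).indicator
            (fun _ => (M * r ^ 2) ^ (-k) * Real.exp (-(c / δ))) s ∂η := by
          rw [integral_indicator_const _ measurableSet_Icc, smul_eq_mul, mul_comm]
      _ ≤ gaussMix η k c r := by
          refine integral_mono_ae ((integrable_const _).indicator measurableSet_Icc)
            (h.integrable_gaussMix hβ0 hκ hk hc.le _) ?_
          filter_upwards [h.ae_pos] with s hs
          by_cases hmem : s ∈ Icc (δ * r ^ 2) (M * r ^ 2)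
          · rw [indicator_of_mem hmem]
            have e2 : (M * r ^ 2) ^ (-k) ≤ s ^ (-k) :=
              Real.rpow_le_rpow_of_nonpos hs hmem.2 (by linarith)
            have e3 : c * r ^ 2 / s ≤ c / δ := by
              rw [div_le_div_iff₀ hs hδ]
              nlinarith [hmem.1]
            gcongr
          · rw [indicator_of_notMem hmem]
            positivity
  refine ⟨A, hA0, fun r hr => ?_⟩
  rcases le_total r 1 with h1 | h1
  · calc A * (1 + r) ^ (-N) ≤ A * (1 : ℝ) ^ (-N) := by
          gcongr ?_ * ?_
          exact Real.rpow_le_rpow_of_nonpos one_pos (by linarith) (by linarith)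
      _ ≤ gaussMix η k c 1 := main 1 le_rfl
      _ ≤ gaussMix η k c r := h.gaussMix_antitone hβ0 hκ hk hc.le hr h1
  · refine le_trans ?_ (main r h1)
    gcongr ?_ * ?_
    exact Real.rpow_le_rpow_of_nonpos (by linarith) (by linarith) (by linarith)

end IsStableSubordinator

/-- Lipschitz bound for a Gaussian in the radial variable, with the constant of a slightly wider
Gaussian. -/
lemma abs_exp_neg_sq_sub_le {c s ρ r r' : ℝ} (hc : 0 < c) (hs : 0 < s) (hρ : 0 ≤ ρ)
    (hr : ρ ≤ r) (hr' : ρ ≤ r') :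
    |Real.exp (-(c * r ^ 2 / s)) - Real.exp (-(c * r' ^ 2 / s))| ≤
      2 * (c + 1) * s ^ (-(1 / 2) : ℝ) * Real.exp (-(c / 2 * ρ ^ 2 / s)) * |r - r'| := by
  have hd : ∀ x ∈ Ici ρ, HasDerivWithinAt (fun x => Real.exp (-(c * x ^ 2 / s)))
      (Real.exp (-(c * x ^ 2 / s)) * (-(c * (2 * x) / s))) (Ici ρ) x := by
    intro x _
    have := ((((hasDerivAt_pow 2 x).const_mul c).div_const s).neg).exp
    have h2 : HasDerivAt (fun x => Real.exp (-(c * x ^ 2 / s)))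
        (Real.exp (-(c * x ^ 2 / s)) * -(c * (((2 : ℕ) : ℝ) * x ^ (2 - 1)) / s)) x := this
    refine (h2.congr_deriv ?_).hasDerivWithinAt
    norm_num
  refine Convex.norm_image_sub_le_of_norm_hasDerivWithin_le hd (fun x hx => ?_)
    (convex_Ici ρ) hr' hr
  have hx0 : 0 ≤ x := hρ.trans hx
  rw [norm_mul, Real.norm_of_nonneg (Real.exp_pos _).le, norm_neg,
    Real.norm_of_nonneg (by positivity)]
  have hsq : s ^ (-(1 / 2) : ℝ) = (√s)⁻¹ := by
    rw [Real.rpow_neg hs.le, Real.sqrt_eq_rpow]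
  set y := x / √s with hy
  have hsq0 : 0 < √s := Real.sqrt_pos.2 hs
  have hs2 : √s ^ 2 = s := Real.sq_sqrt hs.le
  have hy2 : x ^ 2 / s = y ^ 2 := by rw [hy, div_pow, hs2]
  have e1 : Real.exp (-(c * x ^ 2 / s)) =
      Real.exp (-(c / 2 * x ^ 2 / s)) * Real.exp (-(c / 2 * y ^ 2)) := by
    rw [← Real.exp_add, ← hy2]; congr 1; ring
  have e2 : c * (2 * x) / s = 2 * c * y * (√s)⁻¹ := by
    rw [hy]; nth_rw 1 [← hs2]; field_simp
  have e3 : c * y * Real.exp (-(c / 2 * y ^ 2)) ≤ c + 1 := by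
    have h1 : Real.exp (-(c / 2 * y ^ 2)) ≤ (1 + c / 2 * y ^ 2)⁻¹ := by
      rw [Real.exp_neg]
      exact inv_anti₀ (by positivity) (by linarith [Real.add_one_le_exp (c / 2 * y ^ 2)])
    have hy0 : 0 ≤ y := by positivity
    calc c * y * Real.exp (-(c / 2 * y ^ 2)) ≤ c * y * (1 + c / 2 * y ^ 2)⁻¹ := by gcongr
      _ ≤ c + 1 := by
        rw [← div_eq_mul_inv, div_le_iff₀ (by positivity)]
        nlinarith [mul_nonneg hc.le (sq_nonneg (y - 1)), mul_nonneg (mul_nonneg hc.le hc.le)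
          (sq_nonneg y)]
  have e4 : Real.exp (-(c / 2 * x ^ 2 / s)) ≤ Real.exp (-(c / 2 * ρ ^ 2 / s)) := by
    have : ρ ≤ x := hx
    gcongr
  calc Real.exp (-(c * x ^ 2 / s)) * (c * (2 * x) / s)
      = 2 * (c * y * Real.exp (-(c / 2 * y ^ 2))) * (√s)⁻¹ * Real.exp (-(c / 2 * x ^ 2 / s)) := by
        rw [e1, e2]; ring
    _ ≤ 2 * (c + 1) * (√s)⁻¹ * Real.exp (-(c / 2 * ρ ^ 2 / s)) := by gcongr
    _ = _ := by rw [hsq]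

/-- A Gaussian mixture along a stable subordinator has a bounded logarithmic derivative. -/
theorem IsStableSubordinator.abs_gaussMix_sub_le {β κ : ℝ} {η : Measure ℝ}
    (h : IsStableSubordinator β κ η) (hβ0 : 0 < β) (hβ1 : β < 1) (hκ : 0 < κ)
    {k c : ℝ} (hk : 0 < k) (hc : 0 < c) :
    ∃ L, 0 < L ∧ ∀ r r', 0 ≤ r → 0 ≤ r' → |r - r'| ≤ 1 →
      |gaussMix η k c r - gaussMix η k c r'| ≤ L * |r - r'| * gaussMix η k c r' := by
  have := h.isProb
  obtain ⟨C, hC, hup⟩ := h.gaussMix_le hβ0 hκ (k := k + 1 / 2) (c := c / 2) (by linarith)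
    (by linarith)
  obtain ⟨a, ha, hlow⟩ := h.le_gaussMix hβ0 hβ1 hκ hk hc
  set N := 2 * k + 2 * β with hN
  have hN0 : 0 < N := by positivity
  refine ⟨2 * (c + 1) * C * 2 ^ N / a, by positivity, fun r r' hr hr' hrr => ?_⟩
  set ρ := min r r' with hρ
  have hρ0 : 0 ≤ ρ := le_min hr hr'
  have hρ' : (1 + r') / 2 ≤ 1 + ρ := by
    rw [abs_le] at hrr
    rcases min_choice r r' with e | e <;> rw [hρ, e] <;> linarith
  have s1 : |gaussMix η k c r - gaussMix η k c r'| ≤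
      2 * (c + 1) * |r - r'| * gaussMix η (k + 1 / 2) (c / 2) ρ := by
    rw [gaussMix, gaussMix, ← integral_sub (h.integrable_gaussMix hβ0 hκ hk hc.le _)
      (h.integrable_gaussMix hβ0 hκ hk hc.le _), gaussMix, ← integral_const_mul]
    rw [← Real.norm_eq_abs (∫ s, _ ∂η)]
    refine norm_integral_le_of_norm_le ((h.integrable_gaussMix hβ0 hκ (k := k + 1 / 2)
      (c := c / 2) (by linarith) (by linarith) _).const_mul _) ?_
    filter_upwards [h.ae_pos] with s hs
    rw [← mul_sub, norm_mul, Real.norm_of_nonneg (by positivity), Real.norm_eq_abs]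
    calc s ^ (-k) * |Real.exp (-(c * r ^ 2 / s)) - Real.exp (-(c * r' ^ 2 / s))|
        ≤ s ^ (-k) * (2 * (c + 1) * s ^ (-(1 / 2) : ℝ) * Real.exp (-(c / 2 * ρ ^ 2 / s)) *
          |r - r'|) := by
          gcongr
          exact abs_exp_neg_sq_sub_le hc hs hρ0 (min_le_left _ _) (min_le_right _ _)
      _ = _ := by
          rw [neg_add, Real.rpow_add hs]; ring
  have s2 : gaussMix η (k + 1 / 2) (c / 2) ρ ≤ C * (2 ^ N * (1 + r') ^ (-N)) := by
    refine (hup ρ hρ0).trans ?_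
    gcongr
    calc (1 + ρ) ^ (-(2 * (k + 1 / 2) + 2 * β)) ≤ (1 + ρ) ^ (-N) :=
          Real.rpow_le_rpow_of_exponent_le (by linarith) (by rw [hN]; linarith)
      _ ≤ ((1 + r') / 2) ^ (-N) :=
          Real.rpow_le_rpow_of_nonpos (by positivity) hρ' (neg_nonpos.2 hN0.le)
      _ = 2 ^ N * (1 + r') ^ (-N) := by
          rw [Real.div_rpow (by positivity) (by positivity), Real.rpow_neg (by positivity :
            (0 : ℝ) ≤ 2)]
          field_simp
  have s3 : (1 + r') ^ (-N) ≤ gaussMix η k c r' / a := by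
    rw [le_div_iff₀ ha, mul_comm]; exact hlow r' hr'
  calc |gaussMix η k c r - gaussMix η k c r'|
      ≤ 2 * (c + 1) * |r - r'| * gaussMix η (k + 1 / 2) (c / 2) ρ := s1
    _ ≤ 2 * (c + 1) * |r - r'| * (C * (2 ^ N * (1 + r') ^ (-N))) := by gcongr
    _ ≤ 2 * (c + 1) * |r - r'| * (C * (2 ^ N * (gaussMix η k c r' / a))) := by gcongr
    _ = _ := by ring

/-! ### The equilibrium -/

/-- A probability density `m` on `ℝ^d` comparable to `(1+|v|)^{-d-α}` and with bounded
logarithmic derivative (in integrated form, at distances at most `1`). -/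
structure IsStableWeight (d : ℕ) (α : ℝ) (m : Vel d → ℝ) : Prop where
  integral_eq_one : ∫ v, m v = 1
  exists_lower : ∃ a, 0 < a ∧ ∀ v, a * (1 + ‖v‖) ^ (-((d : ℝ) + α)) ≤ m v
  exists_upper : ∃ b, 0 < b ∧ ∀ v, m v ≤ b * (1 + ‖v‖) ^ (-((d : ℝ) + α))
  exists_lipschitz : ∃ L, 0 < L ∧ ∀ v w, ‖v - w‖ ≤ 1 → |m v - m w| ≤ L * ‖v - w‖ * m w

/-- The inverse Fourier transform of a Gaussian whose variance parameter `s` appears in the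
frequency variable. -/
lemma fourierInv_gaussian {d : ℕ} {s : ℝ} (hs : 0 < s) (v : Vel d) :
    ∫ ξ : Vel d, Complex.exp ((2 * Real.pi * inner ℝ ξ v : ℝ) * Complex.I) *
        (Real.exp (-((2 * Real.pi * ‖ξ‖) ^ 2 * s)) : ℂ) =
      ((4 * Real.pi * s) ^ (-((d : ℝ) / 2)) * Real.exp (-(1 / 4 * ‖v‖ ^ 2 / s)) : ℝ) := by
  have hπ := Real.pi_pos
  have hb : 0 < ((4 * Real.pi ^ 2 * s : ℝ) : ℂ).re := by
    rw [Complex.ofReal_re]; positivity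
  have key := GaussianFourier.integral_cexp_neg_mul_sq_norm_add hb (2 * Real.pi * Complex.I) v
  rw [finrank_euclideanSpace_fin] at key
  have e1 : ∀ ξ : Vel d, Complex.exp ((2 * Real.pi * inner ℝ ξ v : ℝ) * Complex.I) *
      (Real.exp (-((2 * Real.pi * ‖ξ‖) ^ 2 * s)) : ℂ) =
      Complex.exp (-((4 * Real.pi ^ 2 * s : ℝ) : ℂ) * ‖ξ‖ ^ 2 +
        2 * Real.pi * Complex.I * (inner ℝ v ξ : ℝ)) := by
    intro ξ
    rw [Complex.ofReal_exp, ← Complex.exp_add, real_inner_comm]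
    congr 1
    push_cast
    ring
  simp_rw [e1]
  rw [key]
  have e2 : ((Real.pi : ℂ) / ((4 * Real.pi ^ 2 * s : ℝ) : ℂ)) ^ ((d : ℂ) / 2) =
      ((4 * Real.pi * s) ^ (-((d : ℝ) / 2)) : ℝ) := by
    rw [← Complex.ofReal_div, show ((d : ℂ) / 2) = ((d / 2 : ℝ) : ℂ) by push_cast; rfl,
      ← Complex.ofReal_cpow (by positivity), Real.rpow_neg (by positivity),
      ← Real.inv_rpow (by positivity)]
    congr 2
    field_simp
  rw [e2]
  conv_rhs => rw [Complex.ofReal_mul, Complex.ofReal_exp]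
  congr 2
  have hs' : (s : ℂ) ≠ 0 := by exact_mod_cast hs.ne'
  have hπ' : (Real.pi : ℂ) ≠ 0 := by exact_mod_cast hπ.ne'
  push_cast
  field_simp
  rw [Complex.I_sq]
  ring

/-- Bochner subordination: the rotation invariant stable density is a Gaussian mixture along the
stable subordinator. -/
theorem stableProfile_eq_gaussMix {d : ℕ} (hd : 1 ≤ d) {α : ℝ} (hα₀ : 0 < α)
    {η : Measure ℝ} (h : IsStableSubordinator (α / 2) (1 / α) η) (v : Vel d) :
    stableProfile d α v =
      (4 * Real.pi) ^ (-((d : ℝ) / 2)) * gaussMix η (d / 2) (1 / 4) ‖v‖ := by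
  have hπ := Real.pi_pos
  have := h.isProb
  have hd0 : (0 : ℝ) < d := by exact_mod_cast hd
  let F : Vel d → ℝ → ℂ := fun ξ s =>
    Complex.exp ((2 * Real.pi * inner ℝ ξ v : ℝ) * Complex.I) *
      (Real.exp (-((2 * Real.pi * ‖ξ‖) ^ 2 * s)) : ℂ)
  have hFn : ∀ ξ s, ‖F ξ s‖ = Real.exp (-((2 * Real.pi * ‖ξ‖) ^ 2 * s)) := by
    intro ξ s
    rw [norm_mul, Complex.norm_exp_ofReal_mul_I, one_mul, Complex.norm_real,
      Real.norm_of_nonneg (Real.exp_pos _).le]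
  have hFc : Continuous (Function.uncurry F) := by
    unfold F Function.uncurry
    fun_prop
  have hint : Integrable (Function.uncurry F) ((volume : Measure (Vel d)).prod η) := by
    rw [integrable_prod_iff' hFc.aestronglyMeasurable]
    constructor
    · filter_upwards [h.ae_pos] with s hs
      refine Integrable.mono' (g := fun ξ : Vel d =>
        Real.exp (-((2 * Real.pi * ‖ξ‖) ^ 2 * s))) ?_ (by
          unfold F Function.uncurry; fun_prop) (Eventually.of_forall fun ξ => (hFn ξ s).le)
      refine Integrable.of_integral_ne_zero ?_
      have := GaussianFourier.integral_rexp_neg_mul_sq_norm (V := Vel d)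
        (b := 4 * Real.pi ^ 2 * s) (by positivity)
      have e : ∀ ξ : Vel d, Real.exp (-((2 * Real.pi * ‖ξ‖) ^ 2 * s)) =
        Real.exp (-(4 * Real.pi ^ 2 * s) * ‖ξ‖ ^ 2) := fun ξ => by congr 1; ring
      simp_rw [e, this]
      positivity
    · refine ((h.integrable_rpow_neg (by linarith) (by positivity)
        (k := (d : ℝ) / 2) (by positivity)).const_mul ((4 * Real.pi) ^ (-((d : ℝ) / 2)))).congr ?_
      filter_upwards [h.ae_pos] with s hs
      have e : ∀ ξ : Vel d, ‖Function.uncurry F (ξ, s)‖ =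
        Real.exp (-(4 * Real.pi ^ 2 * s) * ‖ξ‖ ^ 2) := fun ξ => by
          rw [Function.uncurry_apply_pair, hFn]; congr 1; ring
      simp_rw [e]
      rw [GaussianFourier.integral_rexp_neg_mul_sq_norm (by positivity),
        finrank_euclideanSpace_fin, ← Real.mul_rpow (by positivity) hs.le,
        Real.rpow_neg (by positivity), ← Real.inv_rpow (by positivity)]
      congr 1
      field_simp
  have hswap := integral_integral_swap hint
  have h1 : ∀ ξ : Vel d, ∫ s, F ξ s ∂η =
      Complex.exp ((2 * Real.pi * inner ℝ ξ v : ℝ) * Complex.I) •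
        ((Real.exp (-(2 * Real.pi * ‖ξ‖) ^ α / α) : ℝ) : ℂ) := by
    intro ξ
    rw [integral_const_mul, smul_eq_mul, integral_complex_ofReal]
    congr 2
    rcases eq_or_ne ξ 0 with rfl | hξ
    · simp [Real.zero_rpow hα₀.ne']
    · have hn : 0 < ‖ξ‖ := norm_pos_iff.2 hξ
      rw [h.laplace _ (by positivity), ← Real.rpow_natCast, ← Real.rpow_mul (by positivity)]
      congr 1
      rw [show ((2 : ℕ) : ℝ) * (α / 2) = α by push_cast; ring]
      ring
  have h2 : ∫ s, (∫ ξ : Vel d, F ξ s) ∂η =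
      (((4 * Real.pi) ^ (-((d : ℝ) / 2)) * gaussMix η (d / 2) (1 / 4) ‖v‖ : ℝ) : ℂ) := by
    rw [gaussMix, ← integral_const_mul, ← integral_complex_ofReal]
    refine integral_congr_ae ?_
    filter_upwards [h.ae_pos] with s hs
    rw [fourierInv_gaussian hs, Real.mul_rpow (by positivity) hs.le, mul_assoc]
  rw [stableProfile, Real.fourierInv_eq', ← integral_congr_ae (Eventually.of_forall h1), hswap, h2,
    Complex.ofReal_re]

lemma integrable_one_add_norm_rpow (d : ℕ) {α : ℝ} (hα₀ : 0 < α) :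
    Integrable (fun v : Vel d => (1 + ‖v‖) ^ (-((d : ℝ) + α))) :=
  integrable_one_add_norm (by rw [finrank_euclideanSpace_fin]; linarith)

/-- A function satisfying the logarithmic Lipschitz bound is continuous. -/
lemma continuous_of_log_lipschitz {d : ℕ} {m : Vel d → ℝ} {L : ℝ}
    (h : ∀ v w, ‖v - w‖ ≤ 1 → |m v - m w| ≤ L * ‖v - w‖ * m w) : Continuous m := by
  rw [continuous_iff_continuousAt]
  intro w
  rw [ContinuousAt, tendsto_iff_norm_sub_tendsto_zero]
  refine squeeze_zero' (g := fun v => L * ‖v - w‖ * m w) (Eventually.of_forall fun v =>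
    norm_nonneg _) ?_ ?_
  · filter_upwards [Metric.closedBall_mem_nhds w one_pos] with v hv
    rw [mem_closedBall_iff_norm] at hv
    exact h v w hv
  · have : Continuous fun v => L * ‖v - w‖ * m w := by fun_prop
    simpa using this.tendsto w

namespace IsStableWeight

variable {d : ℕ} {α : ℝ} {m : Vel d → ℝ}

lemma continuous (h : IsStableWeight d α m) : Continuous m := by
  obtain ⟨L, -, hL⟩ := h.exists_lipschitz
  exact continuous_of_log_lipschitz hL

lemma pos (h : IsStableWeight d α m) (v : Vel d) : 0 < m v := by
  obtain ⟨a, ha, hlow⟩ := h.exists_lower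
  exact lt_of_lt_of_le (by positivity) (hlow v)

end IsStableWeight

/-- The equilibrium has the tail of the stable law and a bounded logarithmic derivative. -/
theorem isStableWeight_equilibrium {d : ℕ} (hd : 1 ≤ d) {α : ℝ} (hα₀ : 0 < α) (hα₂ : α < 2) :
    IsStableWeight d α (equilibrium d α) := by
  obtain ⟨η, hη1, hη2, hη3⟩ := exists_stable_subordinator (β := α / 2) (κ := 1 / α)
    (by linarith) (by linarith) (by positivity)
  have h : IsStableSubordinator (α / 2) (1 / α) η := ⟨hη1, hη2, hη3⟩
  have hd0 : (0 : ℝ) < d := by exact_mod_cast hd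
  have hπ := Real.pi_pos
  set A := (4 * Real.pi) ^ (-((d : ℝ) / 2))
  have hA : 0 < A := by positivity
  have hp : ∀ v, stableProfile d α v = A * gaussMix η (d / 2) (1 / 4) ‖v‖ :=
    stableProfile_eq_gaussMix hd hα₀ h
  have hN : -(2 * ((d : ℝ) / 2) + 2 * (α / 2)) = -((d : ℝ) + α) := by ring
  obtain ⟨b, hb, hup⟩ := h.gaussMix_le (k := (d : ℝ) / 2) (c := 1 / 4) (by linarith)
    (by positivity) (by positivity) (by norm_num)
  obtain ⟨a, ha, hlow⟩ := h.le_gaussMix (k := (d : ℝ) / 2) (c := 1 / 4) (by linarith)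
    (by linarith) (by positivity) (by positivity) (by norm_num)
  obtain ⟨L, hL, hlip⟩ := h.abs_gaussMix_sub_le (k := (d : ℝ) / 2) (c := 1 / 4) (by linarith)
    (by linarith) (by positivity) (by positivity) (by norm_num)
  rw [hN] at hup hlow
  have hplow : ∀ v, A * a * (1 + ‖v‖) ^ (-((d : ℝ) + α)) ≤ stableProfile d α v := fun v => by
    rw [hp, mul_assoc]
    exact mul_le_mul_of_nonneg_left (hlow _ (norm_nonneg v)) hA.le
  have hpup : ∀ v, stableProfile d α v ≤ A * b * (1 + ‖v‖) ^ (-((d : ℝ) + α)) := fun v => by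
    rw [hp, mul_assoc]
    exact mul_le_mul_of_nonneg_left (hup _ (norm_nonneg v)) hA.le
  have hppos : ∀ v, 0 < stableProfile d α v := fun v => lt_of_lt_of_le (by positivity) (hplow v)
  have hplip : ∀ v w, ‖v - w‖ ≤ 1 →
      |stableProfile d α v - stableProfile d α w| ≤ L * ‖v - w‖ * stableProfile d α w := by
    intro v w hvw
    have hn := abs_norm_sub_norm_le v w
    rw [hp, hp, ← mul_sub, abs_mul, abs_of_pos hA]
    have h0 := h.gaussMix_nonneg (d / 2) (1 / 4) ‖w‖
    calc A * |gaussMix η (d / 2) (1 / 4) ‖v‖ - gaussMix η (d / 2) (1 / 4) ‖w‖|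
        ≤ A * (L * |‖v‖ - ‖w‖| * gaussMix η (d / 2) (1 / 4) ‖w‖) := by
          gcongr
          exact hlip _ _ (norm_nonneg _) (norm_nonneg _) (hn.trans hvw)
      _ ≤ A * (L * ‖v - w‖ * gaussMix η (d / 2) (1 / 4) ‖w‖) := by gcongr
      _ = _ := by ring
  have hpint : Integrable (stableProfile d α) := by
    refine ((integrable_one_add_norm_rpow d hα₀).const_mul (A * b)).mono'
      (continuous_of_log_lipschitz hplip).aestronglyMeasurable (Eventually.of_forall fun v => ?_)
    rw [Real.norm_of_nonneg (hppos v).le]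
    exact hpup v
  have hZ : 0 < normalizer d α := by
    rw [normalizer, integral_pos_iff_support_of_nonneg (fun v => (hppos v).le) hpint]
    have : Function.support (stableProfile d α) = univ := by
      ext v; simpa using (hppos v).ne'
    rw [this]
    exact isOpen_univ.measure_pos volume univ_nonempty
  set Z := normalizer d α with hZdef
  refine ⟨?_, ⟨Z⁻¹ * (A * a), by positivity, fun v => ?_⟩, ⟨Z⁻¹ * (A * b), by positivity,
    fun v => ?_⟩, ⟨L, hL, fun v w hvw => ?_⟩⟩
  · simp only [equilibrium]
    rw [integral_const_mul, ← hZdef]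
    exact inv_mul_cancel₀ hZ.ne'
  · rw [mul_assoc, equilibrium]
    gcongr
    exact hplow v
  · rw [mul_assoc, equilibrium]
    gcongr
    exact hpup v
  · rw [equilibrium, equilibrium, ← hZdef, ← mul_sub, abs_mul, abs_of_pos (by positivity)]
    calc _ ≤ Z⁻¹ * (L * ‖v - w‖ * stableProfile d α w) := by
          gcongr
          exact hplip v w hvw
      _ = _ := by ring

/-! ### The Poincaré inequality -/

/-- The form `∬ |h(v) - h(w)|² |v-w|^{-N} m(v) dw dv`. -/
noncomputable def dirichletForm {d : ℕ} (N : ℝ) (m h : Vel d → ℝ) : ℝ≥0∞ :=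
  ∫⁻ v, ∫⁻ w, ENNReal.ofReal ((h v - h w) ^ 2 / ‖v - w‖ ^ N * m v)

lemma symForm_eq_dirichletForm (d : ℕ) (α : ℝ) (f : Vel d → ℝ) :
    symForm d α f = ENNReal.ofReal (fracLapConst d α / 2) *
      dirichletForm ((d : ℝ) + α) (equilibrium d α) (fun v => f v / equilibrium d α v) :=
  rfl

lemma aemeasurable_sub_sq {d : ℕ} {h : Vel d → ℝ} (hh : AEMeasurable h) :
    AEMeasurable (fun p : Vel d × Vel d => (h p.1 - h p.2) ^ 2)
      ((volume : Measure (Vel d)).prod volume) :=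
  (hh.comp_fst.sub hh.comp_snd).pow_const 2

/-- Exchanging the two variables in the form. -/
lemma dirichletForm_eq_swap {d : ℕ} {N : ℝ} {m h : Vel d → ℝ} (hm : Measurable m)
    (hh : AEMeasurable h) :
    dirichletForm N m h =
      ∫⁻ v, ∫⁻ w, ENNReal.ofReal ((h v - h w) ^ 2 / ‖v - w‖ ^ N * m w) := by
  rw [dirichletForm, lintegral_lintegral_swap]
  · refine lintegral_congr fun v => lintegral_congr fun w => ?_
    rw [norm_sub_rev, show (h w - h v) ^ 2 = (h v - h w) ^ 2 by ring]
  · have := aemeasurable_sub_sq hh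
    unfold Function.uncurry
    fun_prop

/-- The Cauchy–Schwarz inequality `(∫ φκ)² ≤ (∫ κ) ∫ φ²κ` for a nonnegative kernel `κ`; no
integrability of `φκ` is needed, since the right-hand side is infinite otherwise. -/
lemma ofReal_integral_mul_sq_le {X : Type*} [MeasurableSpace X] {μ : Measure X} {φ κ : X → ℝ}
    (hφ : AEMeasurable φ μ) (hκ : Integrable κ μ) (hκ0 : ∀ x, 0 ≤ κ x) {M : ℝ} (hM : 0 < M)
    (hle : ∫ x, κ x ∂μ ≤ M) :
    ENNReal.ofReal ((∫ x, φ x * κ x ∂μ) ^ 2) ≤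
      ENNReal.ofReal M * ∫⁻ x, ENNReal.ofReal (φ x ^ 2 * κ x) ∂μ := by
  have hκm := hκ.1.aemeasurable
  by_cases hfin : ∫⁻ x, ENNReal.ofReal (φ x ^ 2 * κ x) ∂μ = ⊤
  · rw [hfin, ENNReal.mul_top (by simpa using hM)]; exact le_top
  have hnn : ∀ x, 0 ≤ φ x ^ 2 * κ x := fun x => mul_nonneg (sq_nonneg _) (hκ0 x)
  have hI : Integrable (fun x => φ x ^ 2 * κ x) μ := by
    refine ⟨AEMeasurable.aestronglyMeasurable (by fun_prop), ?_⟩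
    rw [hasFiniteIntegral_iff_ofReal (Eventually.of_forall hnn)]
    exact lt_top_iff_ne_top.2 hfin
  have hi : Integrable (fun x => φ x * κ x) μ := by
    refine (hI.add hκ).mono' (AEMeasurable.aestronglyMeasurable (by fun_prop))
      (Eventually.of_forall fun x => ?_)
    rw [norm_mul, Real.norm_of_nonneg (hκ0 x), Real.norm_eq_abs, Pi.add_apply, ← add_one_mul]
    refine mul_le_mul_of_nonneg_right ?_ (hκ0 x)
    nlinarith [sq_nonneg (|φ x| - 1), sq_abs (φ x), abs_nonneg (φ x)]
  rw [← ofReal_integral_eq_lintegral_ofReal hI (Eventually.of_forall hnn),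
    ← ENNReal.ofReal_mul hM.le]
  refine ENNReal.ofReal_le_ofReal ?_
  set J := ∫ x, φ x * κ x ∂μ with hJ
  set c := J / M with hc
  have hcM : c * M = J := div_mul_cancel₀ _ hM.ne'
  have h1 : ∫ x, (2 * c * (φ x * κ x) - c ^ 2 * κ x) ∂μ ≤ ∫ x, φ x ^ 2 * κ x ∂μ := by
    refine integral_mono ((hi.const_mul _).sub (hκ.const_mul _)) hI fun x => ?_
    have := mul_nonneg (sq_nonneg (φ x - c)) (hκ0 x)
    simp only
    nlinarith
  rw [integral_sub (hi.const_mul _) (hκ.const_mul _), integral_const_mul, integral_const_mul,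
    ← hJ] at h1
  have h2 : c ^ 2 * ∫ x, κ x ∂μ ≤ c ^ 2 * M := mul_le_mul_of_nonneg_left hle (sq_nonneg c)
  have h3 : c * J ≤ ∫ x, φ x ^ 2 * κ x ∂μ := by
    have : c ^ 2 * M = c * J := by rw [← hcM]; ring
    linarith
  calc J ^ 2 = M * (c * J) := by nth_rw 1 [sq, ← hcM]; ring
    _ ≤ _ := mul_le_mul_of_nonneg_left h3 hM.le

namespace IsStableWeight

variable {d : ℕ} {α : ℝ} {m : Vel d → ℝ}

lemma integrable (hm : IsStableWeight d α m) (hα₀ : 0 < α) : Integrable m := by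
  obtain ⟨b, hb, hup⟩ := hm.exists_upper
  refine ((integrable_one_add_norm_rpow d hα₀).const_mul b).mono'
    hm.continuous.aestronglyMeasurable (Eventually.of_forall fun v => ?_)
  rw [Real.norm_of_nonneg (hm.pos v).le]
  exact hup v

/-- The tail of the weight is that of the Lévy kernel: one of `|v|`, `|w|` is at least
`|v-w|/2`. -/
lemma exists_mul_le_kernel (hm : IsStableWeight d α m) (hα₀ : 0 < α) :
    ∃ C, 0 < C ∧ ∀ v w, v ≠ w →
      m v * m w ≤ C * ((m v + m w) / ‖v - w‖ ^ ((d : ℝ) + α)) := by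
  obtain ⟨b, hb, hup⟩ := hm.exists_upper
  set N := (d : ℝ) + α with hN
  have hN0 : 0 < N := by positivity
  have key : ∀ v w : Vel d, v ≠ w → ‖v‖ ≤ ‖w‖ → m w ≤ b * 2 ^ N / ‖v - w‖ ^ N := by
    intro v w hne hle
    have h0 : 0 < ‖v - w‖ := norm_pos_iff.2 (sub_ne_zero.2 hne)
    have h1 : ‖v - w‖ / 2 ≤ 1 + ‖w‖ := by linarith [norm_sub_le v w]
    calc m w ≤ b * (1 + ‖w‖) ^ (-N) := hup w
      _ ≤ b * (‖v - w‖ / 2) ^ (-N) := by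
          gcongr ?_ * ?_
          exact Real.rpow_le_rpow_of_nonpos (by positivity) h1 (by linarith)
      _ = b * 2 ^ N / ‖v - w‖ ^ N := by
          rw [Real.rpow_neg (by positivity), Real.div_rpow h0.le (by positivity)]
          field_simp
  refine ⟨b * 2 ^ N, by positivity, fun v w hne => ?_⟩
  have hv := hm.pos v
  have hw := hm.pos w
  have h0 : 0 < ‖v - w‖ := norm_pos_iff.2 (sub_ne_zero.2 hne)
  rcases le_total ‖v‖ ‖w‖ with hle | hle
  · calc m v * m w ≤ m v * (b * 2 ^ N / ‖v - w‖ ^ N) := by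
          gcongr; exact key v w hne hle
      _ = b * 2 ^ N * (m v / ‖v - w‖ ^ N) := by ring
      _ ≤ _ := by gcongr; linarith
  · calc m v * m w ≤ b * 2 ^ N / ‖w - v‖ ^ N * m w := by
          gcongr; exact key w v hne.symm hle
      _ = b * 2 ^ N * (m w / ‖v - w‖ ^ N) := by rw [norm_sub_rev]; ring
      _ ≤ _ := by gcongr; linarith

lemma exists_lintegral_sub_sq_le (hm : IsStableWeight d α m) (hα₀ : 0 < α) :
    ∃ C, 0 < C ∧ ∀ h : Vel d → ℝ, AEMeasurable h →
      ∫⁻ v, ∫⁻ w, ENNReal.ofReal ((h v - h w) ^ 2 * m v * m w) ≤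
        ENNReal.ofReal C * dirichletForm ((d : ℝ) + α) m h := by
  obtain ⟨C, hC, hle⟩ := hm.exists_mul_le_kernel hα₀
  have hmm := hm.continuous.measurable
  refine ⟨C * 2, by positivity, fun h hh => ?_⟩
  set N := (d : ℝ) + α
  have hmeas : AEMeasurable (fun p : Vel d × Vel d =>
      ENNReal.ofReal ((h p.1 - h p.2) ^ 2 / ‖p.1 - p.2‖ ^ N * m p.1))
      ((volume : Measure (Vel d)).prod volume) := by
    have := aemeasurable_sub_sq hh
    fun_prop
  have hpt : ∀ v w, ENNReal.ofReal ((h v - h w) ^ 2 * m v * m w) ≤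
      ENNReal.ofReal C * (ENNReal.ofReal ((h v - h w) ^ 2 / ‖v - w‖ ^ N * m v) +
        ENNReal.ofReal ((h v - h w) ^ 2 / ‖v - w‖ ^ N * m w)) := by
    intro v w
    have hv := hm.pos v
    have hw := hm.pos w
    rw [← ENNReal.ofReal_add (by positivity) (by positivity), ← ENNReal.ofReal_mul hC.le]
    refine ENNReal.ofReal_le_ofReal ?_
    rcases eq_or_ne v w with rfl | hne
    · simp
    · calc (h v - h w) ^ 2 * m v * m w = (h v - h w) ^ 2 * (m v * m w) := by ring
        _ ≤ (h v - h w) ^ 2 * (C * ((m v + m w) / ‖v - w‖ ^ N)) := by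
            exact mul_le_mul_of_nonneg_left (hle v w hne) (sq_nonneg _)
        _ = _ := by ring
  calc ∫⁻ v, ∫⁻ w, ENNReal.ofReal ((h v - h w) ^ 2 * m v * m w)
      ≤ ∫⁻ v, ∫⁻ w, ENNReal.ofReal C *
          (ENNReal.ofReal ((h v - h w) ^ 2 / ‖v - w‖ ^ N * m v) +
        ENNReal.ofReal ((h v - h w) ^ 2 / ‖v - w‖ ^ N * m w)) :=
        lintegral_mono fun v => lintegral_mono fun w => hpt v w
    _ = ENNReal.ofReal C * ∫⁻ v, ((∫⁻ w, ENNReal.ofReal ((h v - h w) ^ 2 / ‖v - w‖ ^ N * m v)) +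
        ∫⁻ w, ENNReal.ofReal ((h v - h w) ^ 2 / ‖v - w‖ ^ N * m w)) := by
        rw [← lintegral_const_mul' _ _ ENNReal.ofReal_ne_top]
        refine lintegral_congr fun v => ?_
        rw [lintegral_const_mul' _ _ ENNReal.ofReal_ne_top, lintegral_add_left']
        fun_prop
    _ = ENNReal.ofReal C * (dirichletForm N m h + dirichletForm N m h) := by
        rw [lintegral_add_left' hmeas.lintegral_prod_right']
        congr 2
        exact (dirichletForm_eq_swap hmm hh).symm
    _ = ENNReal.ofReal (C * 2) * dirichletForm N m h := by
        rw [ENNReal.ofReal_mul hC.le, ← two_mul]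
        simp [mul_assoc]

/-- Jensen's inequality for the probability measure `m(w) dw`. -/
lemma ofReal_sub_integral_sq_le (hm : IsStableWeight d α m) (hα₀ : 0 < α) {h : Vel d → ℝ}
    (hh : AEMeasurable h) (hi : Integrable fun w => h w * m w) (x : ℝ) :
    ENNReal.ofReal ((x - ∫ w, h w * m w) ^ 2) ≤ ∫⁻ w, ENNReal.ofReal ((x - h w) ^ 2 * m w) := by
  have hmi := hm.integrable hα₀
  have key := ofReal_integral_mul_sq_le (hh.const_sub x) hmi (fun v => (hm.pos v).le) one_pos
    hm.integral_eq_one.le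
  simp only [sub_mul, ENNReal.ofReal_one, one_mul] at key
  rwa [integral_sub (hmi.const_mul x) hi, integral_const_mul, hm.integral_eq_one, mul_one] at key

/-- The Poincaré inequality for the stable weight. -/
theorem exists_poincare (hm : IsStableWeight d α m) (hα₀ : 0 < α) :
    ∃ C, 0 < C ∧ ∀ h : Vel d → ℝ, AEMeasurable h → (Integrable fun w => h w * m w) →
      ∫⁻ v, ENNReal.ofReal ((h v - ∫ w, h w * m w) ^ 2 * m v) ≤
        ENNReal.ofReal C * dirichletForm ((d : ℝ) + α) m h := by
  obtain ⟨C, hC, hle⟩ := hm.exists_lintegral_sub_sq_le hα₀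
  refine ⟨C, hC, fun h hh hi => (lintegral_mono fun v => ?_).trans (hle h hh)⟩
  rw [ENNReal.ofReal_mul (sq_nonneg _), mul_comm]
  calc ENNReal.ofReal (m v) * ENNReal.ofReal ((h v - ∫ w, h w * m w) ^ 2)
      ≤ ENNReal.ofReal (m v) * ∫⁻ w, ENNReal.ofReal ((h v - h w) ^ 2 * m w) := by
        gcongr
        exact hm.ofReal_sub_integral_sq_le hα₀ hh hi _
    _ = _ := by
        rw [← lintegral_const_mul' _ _ ENNReal.ofReal_ne_top]
        refine lintegral_congr fun w => ?_
        rw [← ENNReal.ofReal_mul (hm.pos v).le]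
        congr 1; ring

/-- Finiteness of the form forces square integrability against the weight. -/
lemma lintegral_sq_lt_top (hm : IsStableWeight d α m) (hα₀ : 0 < α) {h : Vel d → ℝ}
    (hh : AEMeasurable h) (hfin : dirichletForm ((d : ℝ) + α) m h ≠ ⊤) :
    ∫⁻ v, ENNReal.ofReal (h v ^ 2 * m v) < ⊤ := by
  obtain ⟨C, hC, hle⟩ := hm.exists_lintegral_sub_sq_le hα₀
  have hmm := hm.continuous.measurable
  have hmi := hm.integrable hα₀
  have h1 : ∫⁻ v, ∫⁻ w, ENNReal.ofReal ((h v - h w) ^ 2 * m v * m w) ≠ ⊤ :=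
    ne_top_of_le_ne_top (ENNReal.mul_ne_top ENNReal.ofReal_ne_top hfin) (hle h hh)
  have hmeas : AEMeasurable (fun p : Vel d × Vel d =>
      ENNReal.ofReal ((h p.1 - h p.2) ^ 2 * m p.1 * m p.2))
      ((volume : Measure (Vel d)).prod volume) := by
    have := aemeasurable_sub_sq hh
    fun_prop
  have h2 := ae_lt_top' hmeas.lintegral_prod_right' h1
  obtain ⟨v, hv⟩ := h2.exists
  have hmv := hm.pos v
  have hpt : ∀ w, ENNReal.ofReal (h w ^ 2 * m w) ≤
      ENNReal.ofReal (2 / m v) * ENNReal.ofReal ((h v - h w) ^ 2 * m v * m w) +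
        ENNReal.ofReal (2 * h v ^ 2) * ENNReal.ofReal (m w) := by
    intro w
    have hw := hm.pos w
    rw [← ENNReal.ofReal_mul (by positivity), ← ENNReal.ofReal_mul (by positivity),
      ← ENNReal.ofReal_add (by positivity) (by positivity)]
    refine ENNReal.ofReal_le_ofReal ?_
    have e : 2 / m v * ((h v - h w) ^ 2 * m v * m w) + 2 * h v ^ 2 * m w =
      (2 * (h v - h w) ^ 2 + 2 * h v ^ 2) * m w := by field_simp
    rw [e]
    gcongr
    nlinarith [sq_nonneg (2 * h v - h w)]
  refine (lintegral_mono hpt).trans_lt ?_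
  rw [lintegral_add_right _ (by fun_prop), lintegral_const_mul' _ _ ENNReal.ofReal_ne_top,
    lintegral_const_mul' _ _ ENNReal.ofReal_ne_top]
  refine ENNReal.add_lt_top.2 ⟨ENNReal.mul_lt_top ENNReal.ofReal_lt_top hv,
    ENNReal.mul_lt_top ENNReal.ofReal_lt_top hmi.lintegral_lt_top⟩

end IsStableWeight

/-! ### From the weighted form to the Gagliardo seminorm -/

lemma integrable_indicator_norm_rpow {d : ℕ} (hd : 1 ≤ d) {α : ℝ} (hα₂ : α < 2) :
    Integrable ((Metric.ball (0 : Vel d) 2).indicator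
      fun z => ‖z‖ ^ (2 - ((d : ℝ) + α))) := by
  have : Nonempty (Fin d) := ⟨⟨0, hd⟩⟩
  rw [integrable_indicator_iff measurableSet_ball,
    integrableOn_fun_norm_addHaar volume (f := fun y => y ^ (2 - ((d : ℝ) + α))),
    finrank_euclideanSpace_fin, ← integrableOn_Ioc_iff_integrableOn_Ioo]
  have h : IntegrableOn (fun s : ℝ => s ^ (1 - α)) (Ioc 0 2) :=
    (intervalIntegrable_iff_integrableOn_Ioc_of_le zero_le_two).1
      (intervalIntegral.intervalIntegrable_rpow' (by linarith))
  refine h.congr_fun (fun s hs => ?_) measurableSet_Ioc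
  have hs0 : 0 < s := hs.1
  simp only [smul_eq_mul]
  rw [← Real.rpow_natCast, ← Real.rpow_add hs0, Nat.cast_sub hd]
  congr 1; push_cast; ring

namespace IsStableWeight

variable {d : ℕ} {α : ℝ} {m : Vel d → ℝ}

/-- The carré du champ of `√m` for the Lévy kernel is bounded by `m`: near the diagonal by the
bounded logarithmic derivative, away from it because `m` and the kernel have the same tail. -/
lemma exists_lintegral_sqrt_sub_sq_le (hm : IsStableWeight d α m) (hd : 1 ≤ d) (hα₀ : 0 < α)
    (hα₂ : α < 2) :
    ∃ C, 0 < C ∧ ∀ w, ∫⁻ v, ENNReal.ofReal ((√(m v) - √(m w)) ^ 2 / ‖v - w‖ ^ ((d : ℝ) + α)) ≤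
      ENNReal.ofReal (C * m w) := by
  obtain ⟨a, ha, hlow⟩ := hm.exists_lower
  obtain ⟨b, hb, hup⟩ := hm.exists_upper
  obtain ⟨L, hL, hlip⟩ := hm.exists_lipschitz
  set N := (d : ℝ) + α with hN
  have hN0 : 0 < N := by positivity
  -- `G1` serves near the diagonal, where it is integrable because `α < 2`, and `G2` away from it
  let G1 : Vel d → ℝ := (Metric.ball (0 : Vel d) 2).indicator fun z => ‖z‖ ^ (2 - N)
  let G2 : Vel d → ℝ := fun z => (1 + ‖z‖) ^ (-N)
  have hG1 : Integrable G1 := integrable_indicator_norm_rpow hd hα₂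
  have hG2 : Integrable G2 := integrable_one_add_norm_rpow d hα₀
  have hG1n : ∀ z, 0 ≤ G1 z := fun z => indicator_nonneg (fun z _ => by positivity) z
  have hG2n : ∀ z, 0 ≤ G2 z := fun z => by positivity
  set B := 2 ^ N * (1 + b * 2 ^ N / a) with hB
  have hB0 : 0 < B := by positivity
  have hI1 : 0 ≤ ∫ z, G1 z := integral_nonneg hG1n
  have hI2 : 0 ≤ ∫ z, G2 z := integral_nonneg hG2n
  have key : ∀ v w, (√(m v) - √(m w)) ^ 2 / ‖v - w‖ ^ N ≤
      m w * (L ^ 2 * G1 (v - w) + B * (G2 (v - w) + G2 v)) := by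
    intro v w
    have hv := hm.pos v
    have hw := hm.pos w
    have g1 := hG1n (v - w)
    have g2 := hG2n (v - w)
    have g2' := hG2n v
    rcases eq_or_ne v w with rfl | hne
    · rw [sub_self, zero_pow two_ne_zero, zero_div]
      positivity
    have h0 : 0 < ‖v - w‖ := norm_pos_iff.2 (sub_ne_zero.2 hne)
    rcases le_or_gt ‖v - w‖ 1 with h1 | h1
    · have e1 : (√(m v) - √(m w)) ^ 2 ≤ L ^ 2 * ‖v - w‖ ^ 2 * m w := by
        have s1 : m v - m w = (√(m v) - √(m w)) * (√(m v) + √(m w)) := by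
          have := Real.mul_self_sqrt hv.le
          have := Real.mul_self_sqrt hw.le
          nlinarith
        have s2 := hlip v w h1
        have s3 : 0 < √(m w) := Real.sqrt_pos.2 hw
        have s4 : |√(m v) - √(m w)| ≤ L * ‖v - w‖ * √(m w) := by
          rw [s1, abs_mul, abs_of_pos (by positivity : 0 < √(m v) + √(m w))] at s2
          have s5 : |√(m v) - √(m w)| * √(m w) ≤ L * ‖v - w‖ * √(m w) * √(m w) := by
            rw [mul_assoc, Real.mul_self_sqrt hw.le]
            refine le_trans ?_ s2
            gcongr
            linarith [Real.sqrt_nonneg (m v)]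
          exact le_of_mul_le_mul_right s5 s3
        calc (√(m v) - √(m w)) ^ 2 = |√(m v) - √(m w)| ^ 2 := (sq_abs _).symm
          _ ≤ (L * ‖v - w‖ * √(m w)) ^ 2 := by gcongr
          _ = _ := by rw [mul_pow, mul_pow, Real.sq_sqrt hw.le]
      have e2 : G1 (v - w) = ‖v - w‖ ^ 2 / ‖v - w‖ ^ N := by
        have : v - w ∈ Metric.ball (0 : Vel d) 2 := by
          rw [mem_ball_zero_iff]; linarith
        simp only [G1]
        rw [indicator_of_mem this, Real.rpow_sub h0]
        norm_num
      calc (√(m v) - √(m w)) ^ 2 / ‖v - w‖ ^ N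
          ≤ L ^ 2 * ‖v - w‖ ^ 2 * m w / ‖v - w‖ ^ N := by gcongr
        _ = m w * (L ^ 2 * G1 (v - w)) := by rw [e2]; ring
        _ ≤ _ := by
          gcongr
          linarith [mul_nonneg hB0.le (add_nonneg g2 g2')]
    · have e1 : (√(m v) - √(m w)) ^ 2 ≤ m v + m w := by
        nlinarith [Real.mul_self_sqrt hv.le, Real.mul_self_sqrt hw.le,
          mul_nonneg (Real.sqrt_nonneg (m v)) (Real.sqrt_nonneg (m w))]
      have e2 : (‖v - w‖ ^ N)⁻¹ ≤ 2 ^ N * G2 (v - w) := by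
        simp only [G2]
        rw [Real.rpow_neg (by positivity), ← div_eq_mul_inv, inv_eq_one_div,
          div_le_div_iff₀ (by positivity) (by positivity), one_mul,
          ← Real.mul_rpow (by positivity) (by positivity)]
        gcongr
        linarith
      -- one of `v`, `v - w` has norm at least `‖w‖ / 2`
      have e3 : G2 v * G2 (v - w) ≤ 2 ^ N * G2 w * (G2 (v - w) + G2 v) := by
        have aux : ∀ x : Vel d, ‖w‖ / 2 ≤ ‖x‖ → G2 x ≤ 2 ^ N * G2 w := by
          intro x hx
          simp only [G2]
          calc (1 + ‖x‖) ^ (-N) ≤ ((1 + ‖w‖) / 2) ^ (-N) :=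
                Real.rpow_le_rpow_of_nonpos (by positivity) (by linarith) (by linarith)
            _ = 2 ^ N * (1 + ‖w‖) ^ (-N) := by
                rw [Real.div_rpow (by positivity) (by positivity), Real.rpow_neg (by positivity :
                  (0 : ℝ) ≤ 2)]
                field_simp
        have gw := hG2n w
        have tri : ‖w‖ ≤ ‖v‖ + ‖v - w‖ := by
          calc ‖w‖ = ‖v - (v - w)‖ := by congr 1; abel
            _ ≤ _ := norm_sub_le _ _
        rcases le_total (‖w‖ / 2) ‖v‖ with hx | hx
        · calc G2 v * G2 (v - w) ≤ 2 ^ N * G2 w * G2 (v - w) := by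
                gcongr; exact aux v hx
            _ ≤ _ := by gcongr; linarith
        · calc G2 v * G2 (v - w) ≤ G2 v * (2 ^ N * G2 w) := by
                gcongr; exact aux (v - w) (by linarith)
            _ = 2 ^ N * G2 w * G2 v := by ring
            _ ≤ _ := by gcongr; linarith
      have e4 : G2 w ≤ m w / a := by
        rw [le_div_iff₀ ha, mul_comm]; exact hlow w
      have e5 : m v * G2 (v - w) ≤ b * (2 ^ N * (m w / a) * (G2 (v - w) + G2 v)) := by
        calc m v * G2 (v - w) ≤ b * G2 v * G2 (v - w) :=
              mul_le_mul_of_nonneg_right (hup v) g2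
          _ = b * (G2 v * G2 (v - w)) := by ring
          _ ≤ b * (2 ^ N * G2 w * (G2 (v - w) + G2 v)) := mul_le_mul_of_nonneg_left e3 hb.le
          _ ≤ _ := by gcongr
      calc (√(m v) - √(m w)) ^ 2 / ‖v - w‖ ^ N
          ≤ (m v + m w) * (‖v - w‖ ^ N)⁻¹ := by
            rw [div_eq_mul_inv]; gcongr
        _ ≤ (m v + m w) * (2 ^ N * G2 (v - w)) := by gcongr
        _ = 2 ^ N * (m w * G2 (v - w)) + 2 ^ N * (m v * G2 (v - w)) := by ring
        _ ≤ 2 ^ N * (m w * (G2 (v - w) + G2 v)) +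
              2 ^ N * (b * (2 ^ N * (m w / a) * (G2 (v - w) + G2 v))) := by
            gcongr ?_ + 2 ^ N * ?_
            gcongr
            linarith
        _ = m w * (B * (G2 (v - w) + G2 v)) := by rw [hB]; field_simp
        _ ≤ _ := by
            gcongr
            linarith [mul_nonneg (sq_nonneg L) g1]
  refine ⟨L ^ 2 * (∫ z, G1 z) + B * ((∫ z, G2 z) + ∫ z, G2 z) + 1, by positivity, fun w => ?_⟩
  have hw := hm.pos w
  have i1 := (hG1.comp_sub_right w).const_mul (L ^ 2)
  have i2 := ((hG2.comp_sub_right w).add hG2).const_mul B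
  have i3 : Integrable fun v => m w * (L ^ 2 * G1 (v - w) + B * (G2 (v - w) + G2 v)) :=
    (i1.add i2).const_mul (m w)
  have i0 : ∀ v, 0 ≤ m w * (L ^ 2 * G1 (v - w) + B * (G2 (v - w) + G2 v)) := fun v => by
    have g1 := hG1n (v - w)
    have g2 := hG2n (v - w)
    have g2' := hG2n v
    positivity
  calc ∫⁻ v, ENNReal.ofReal ((√(m v) - √(m w)) ^ 2 / ‖v - w‖ ^ N)
      ≤ ∫⁻ v, ENNReal.ofReal (m w * (L ^ 2 * G1 (v - w) + B * (G2 (v - w) + G2 v))) :=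
        lintegral_mono fun v => ENNReal.ofReal_le_ofReal (key v w)
    _ = ENNReal.ofReal (∫ v, m w * (L ^ 2 * G1 (v - w) + B * (G2 (v - w) + G2 v))) :=
        (ofReal_integral_eq_lintegral_ofReal i3 (Eventually.of_forall i0)).symm
    _ ≤ _ := by
        refine ENNReal.ofReal_le_ofReal ?_
        have i2' : Integrable fun v => B * (G2 (v - w) + G2 v) := i2
        rw [integral_const_mul, integral_add i1 i2', integral_const_mul, integral_const_mul,
          integral_add (hG2.comp_sub_right w) hG2, integral_sub_right_eq_self G1 w,
          integral_sub_right_eq_self G2 w, mul_comm]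
        refine mul_le_mul_of_nonneg_right ?_ hw.le
        linarith

/-- The ground state transformation `k ↦ k √m` maps the weighted form, completed by the weighted
`L²` norm, to the Gagliardo seminorm. -/
theorem exists_gagliardo_le (hm : IsStableWeight d α m) (hd : 1 ≤ d) (hα₀ : 0 < α)
    (hα₂ : α < 2) :
    ∃ C, 0 < C ∧ ∀ k : Vel d → ℝ, AEMeasurable k →
      ∫⁻ v, ∫⁻ w, ENNReal.ofReal
        ((k v * √(m v) - k w * √(m w)) ^ 2 / ‖v - w‖ ^ ((d : ℝ) + α)) ≤
      ENNReal.ofReal 2 * dirichletForm ((d : ℝ) + α) m k +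
        ENNReal.ofReal C * ∫⁻ w, ENNReal.ofReal (k w ^ 2 * m w) := by
  obtain ⟨C, hC, hle⟩ := hm.exists_lintegral_sqrt_sub_sq_le hd hα₀ hα₂
  have hmm := hm.continuous.measurable
  refine ⟨2 * C, by positivity, fun k hk => ?_⟩
  set N := (d : ℝ) + α
  have hmeas : AEMeasurable (fun p : Vel d × Vel d =>
      ENNReal.ofReal 2 * ENNReal.ofReal ((k p.1 - k p.2) ^ 2 / ‖p.1 - p.2‖ ^ N * m p.1))
      ((volume : Measure (Vel d)).prod volume) := by
    have := aemeasurable_sub_sq hk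
    fun_prop
  have hpt : ∀ v w, ENNReal.ofReal ((k v * √(m v) - k w * √(m w)) ^ 2 / ‖v - w‖ ^ N) ≤
      ENNReal.ofReal 2 * ENNReal.ofReal ((k v - k w) ^ 2 / ‖v - w‖ ^ N * m v) +
      ENNReal.ofReal (2 * k w ^ 2) *
        ENNReal.ofReal ((√(m v) - √(m w)) ^ 2 / ‖v - w‖ ^ N) := by
    intro v w
    have hv := hm.pos v
    rw [← ENNReal.ofReal_mul (by positivity),
      ← ENNReal.ofReal_mul (by positivity), ← ENNReal.ofReal_add (by positivity) (by positivity)]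
    refine ENNReal.ofReal_le_ofReal ?_
    have e : (k v * √(m v) - k w * √(m w)) ^ 2 ≤
        2 * ((k v - k w) ^ 2 * m v) + 2 * k w ^ 2 * (√(m v) - √(m w)) ^ 2 := by
      have e1 : (k v - k w) ^ 2 * m v = ((k v - k w) * √(m v)) ^ 2 := by
        rw [mul_pow, Real.sq_sqrt hv.le]
      rw [e1]
      nlinarith [sq_nonneg ((k v - k w) * √(m v) - k w * (√(m v) - √(m w)))]
    calc (k v * √(m v) - k w * √(m w)) ^ 2 / ‖v - w‖ ^ N
        ≤ (2 * ((k v - k w) ^ 2 * m v) + 2 * k w ^ 2 * (√(m v) - √(m w)) ^ 2) / ‖v - w‖ ^ N := by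
          gcongr
      _ = _ := by ring
  calc ∫⁻ v, ∫⁻ w, ENNReal.ofReal ((k v * √(m v) - k w * √(m w)) ^ 2 / ‖v - w‖ ^ N)
      ≤ ∫⁻ v, ∫⁻ w, (ENNReal.ofReal 2 * ENNReal.ofReal ((k v - k w) ^ 2 / ‖v - w‖ ^ N * m v) +
        ENNReal.ofReal (2 * k w ^ 2) *
          ENNReal.ofReal ((√(m v) - √(m w)) ^ 2 / ‖v - w‖ ^ N)) :=
        lintegral_mono fun v => lintegral_mono fun w => hpt v w
    _ = (∫⁻ v, ∫⁻ w, ENNReal.ofReal 2 * ENNReal.ofReal ((k v - k w) ^ 2 / ‖v - w‖ ^ N * m v)) +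
        ∫⁻ v, ∫⁻ w, ENNReal.ofReal (2 * k w ^ 2) *
          ENNReal.ofReal ((√(m v) - √(m w)) ^ 2 / ‖v - w‖ ^ N) := by
        rw [← lintegral_add_left' hmeas.lintegral_prod_right']
        refine lintegral_congr fun v => ?_
        rw [lintegral_add_left']
        fun_prop
    _ ≤ _ := by
        gcongr ?_ + ?_
        · rw [dirichletForm, ← lintegral_const_mul' _ _ ENNReal.ofReal_ne_top]
          refine le_of_eq (lintegral_congr fun v => ?_)
          rw [lintegral_const_mul' _ _ ENNReal.ofReal_ne_top]
        · rw [lintegral_lintegral_swap]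
          · rw [← lintegral_const_mul' _ _ ENNReal.ofReal_ne_top]
            refine lintegral_mono fun w => ?_
            have hw := hm.pos w
            rw [lintegral_const_mul' _ _ ENNReal.ofReal_ne_top]
            refine (mul_le_mul_right (hle w) _).trans (le_of_eq ?_)
            rw [← ENNReal.ofReal_mul (by positivity), ← ENNReal.ofReal_mul (by positivity)]
            congr 1; ring
          · have := hk.comp_snd (μ := (volume : Measure (Vel d)))
            unfold Function.uncurry
            fun_prop

end IsStableWeight

/-! ### The fractional Sobolev seminorm is controlled by the Gagliardo seminorm -/

lemma eLpNorm_two_sq {X E : Type*} [MeasurableSpace X] [NormedAddCommGroup E] (f : X → E)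
    (μ : Measure X) : eLpNorm f 2 μ ^ 2 = ∫⁻ x, ‖f x‖ₑ ^ 2 ∂μ := by
  rw [eLpNorm_eq_lintegral_rpow_enorm_toReal two_ne_zero ENNReal.ofNat_ne_top,
    ← ENNReal.rpow_natCast, ← ENNReal.rpow_mul]
  simp

/-- The phase `e^{-2πi z·ξ}`, by which the Fourier transform intertwines translation by `z`. -/
noncomputable def translationPhase {d : ℕ} (z ξ : Vel d) : ℂ :=
  Complex.exp ((-(2 * Real.pi * inner ℝ z ξ) : ℝ) * Complex.I)

lemma norm_translationPhase {d : ℕ} (z ξ : Vel d) : ‖translationPhase z ξ‖ = 1 :=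
  Complex.norm_exp_ofReal_mul_I _

lemma continuous_translationPhase {d : ℕ} :
    Continuous fun p : Vel d × Vel d => translationPhase p.1 p.2 := by
  unfold translationPhase
  fun_prop

lemma memLp_translationPhase {d : ℕ} (z : Vel d) :
    MemLp (translationPhase z) ⊤ (volume : Measure (Vel d)) :=
  memLp_top_of_bound
    (continuous_translationPhase.comp (Continuous.prodMk_right z)).aestronglyMeasurable 1
    (Eventually.of_forall fun ξ => (norm_translationPhase z ξ).le)

lemma fourier_schwartz_translate {d : ℕ} (z : Vel d) (f : SchwartzMap (Vel d) ℂ) (ξ : Vel d) :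
    (𝓕 (f.compSubConstCLM ℂ z) : SchwartzMap (Vel d) ℂ) ξ =
      translationPhase z ξ * (𝓕 f : SchwartzMap (Vel d) ℂ) ξ := by
  rw [SchwartzMap.fourier_coe, SchwartzMap.fourier_coe, Real.fourier_eq', Real.fourier_eq',
    ← integral_const_mul]
  rw [← integral_add_right_eq_self _ z]
  refine integral_congr_ae (Eventually.of_forall fun v => ?_)
  simp only [SchwartzMap.compSubConstCLM_apply, add_sub_cancel_right, smul_eq_mul,
    translationPhase]
  rw [← mul_assoc, ← Complex.exp_add, inner_add_left]
  congr 2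
  push_cast
  ring

/-- The Fourier transform on `L²` turns translations into multiplications by phases. -/
theorem fourier_translate {d : ℕ} (z : Vel d) (h : Lp ℂ 2 (volume : Measure (Vel d))) :
    (𝓕 (Lp.compMeasurePreserving (fun v => v - z) (measurePreserving_sub_right volume z) h) :
      Lp ℂ 2 (volume : Measure (Vel d))) =ᵐ[volume]
      fun ξ => translationPhase z ξ * (𝓕 h : Lp ℂ 2 (volume : Measure (Vel d))) ξ := by
  let χ : Lp ℂ ⊤ (volume : Measure (Vel d)) := (memLp_translationPhase z).toLp _
  let M : Lp ℂ 2 (volume : Measure (Vel d)) →L[ℂ] Lp ℂ 2 (volume : Measure (Vel d)) :=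
    (ContinuousLinearMap.mul ℂ ℂ).holderL volume ⊤ 2 2 χ
  have hM : ∀ g : Lp ℂ 2 (volume : Measure (Vel d)),
      M g =ᵐ[volume] fun ξ => translationPhase z ξ * g ξ := by
    intro g
    have h1 : M g =ᵐ[volume] fun ξ => ContinuousLinearMap.mul ℂ ℂ (χ ξ) (g ξ) :=
      ContinuousLinearMap.coeFn_holder (ContinuousLinearMap.mul ℂ ℂ) χ g
    filter_upwards [h1, (memLp_translationPhase z).coeFn_toLp] with ξ e1 e2
    rw [e1, e2]
    rfl
  suffices H : 𝓕 (Lp.compMeasurePreserving (fun v => v - z)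
      (measurePreserving_sub_right volume z) h) = M (𝓕 h) by
    rw [H]; exact hM _
  refine DenseRange.induction_on (p := fun h : Lp ℂ 2 (volume : Measure (Vel d)) =>
    𝓕 (Lp.compMeasurePreserving (fun v => v - z)
      (measurePreserving_sub_right volume z) h) = M (𝓕 h))
    (SchwartzMap.denseRange_toLpCLM (p := 2) ENNReal.ofNat_ne_top) h ?_ ?_
  · refine isClosed_eq ?_ ?_
    · exact (Lp.fourierTransformₗᵢ (Vel d) ℂ).continuous.comp
        (Lp.isometry_compMeasurePreserving (measurePreserving_sub_right volume z)).continuous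
    · exact M.continuous.comp (Lp.fourierTransformₗᵢ (Vel d) ℂ).continuous
  · intro f
    have e1 : Lp.compMeasurePreserving (fun v => v - z) (measurePreserving_sub_right volume z)
        (f.toLp 2) = (f.compSubConstCLM ℂ z).toLp 2 := by
      refine Lp.ext ?_
      filter_upwards [Lp.coeFn_compMeasurePreserving (f.toLp 2 volume)
          (measurePreserving_sub_right volume z),
        (measurePreserving_sub_right volume z).quasiMeasurePreserving.ae
          (f.coeFn_toLp 2 volume), (f.compSubConstCLM ℂ z).coeFn_toLp 2 volume] with v a1 a2 a3
      rw [a1, a3]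
      exact a2
    change 𝓕 (Lp.compMeasurePreserving (fun v => v - z) (measurePreserving_sub_right volume z)
        (f.toLp 2)) = M (𝓕 (f.toLp 2))
    rw [e1, SchwartzMap.toLp_fourier_eq, SchwartzMap.toLp_fourier_eq]
    refine Lp.ext ?_
    filter_upwards [hM ((𝓕 f : SchwartzMap (Vel d) ℂ).toLp 2 volume),
      (𝓕 f : SchwartzMap (Vel d) ℂ).coeFn_toLp 2 volume,
      (𝓕 (f.compSubConstCLM ℂ z) : SchwartzMap (Vel d) ℂ).coeFn_toLp 2 volume] with ξ a1 a2 a3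
    rw [a1, a2, a3, fourier_schwartz_translate]

/-- Plancherel's formula for a difference `h(· - z) - h`. -/
theorem lintegral_translate_sub_sq {d : ℕ} (z : Vel d)
    (h : Lp ℂ 2 (volume : Measure (Vel d))) :
    ∫⁻ v, ‖h (v - z) - h v‖ₑ ^ 2 =
      ∫⁻ ξ, ‖translationPhase z ξ - 1‖ₑ ^ 2 *
        ‖(𝓕 h : Lp ℂ 2 (volume : Measure (Vel d))) ξ‖ₑ ^ 2 := by
  set T := Lp.compMeasurePreserving (fun v => v - z) (measurePreserving_sub_right volume z) h
  have h1 : ‖(𝓕 (T - h) : Lp ℂ 2 (volume : Measure (Vel d)))‖ₑ = ‖T - h‖ₑ := by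
    rw [← ofReal_norm, ← ofReal_norm, Lp.norm_fourier_eq]
  have h2 : (𝓕 (T - h) : Lp ℂ 2 (volume : Measure (Vel d))) = 𝓕 T - 𝓕 h :=
    (Lp.fourierTransformₗᵢ (Vel d) ℂ).map_sub T h
  rw [h2, Lp.enorm_def, Lp.enorm_def] at h1
  have h3 := congrArg (· ^ 2) h1
  simp only [eLpNorm_two_sq] at h3
  have e1 : ∫⁻ v, ‖(T - h) v‖ₑ ^ 2 = ∫⁻ v, ‖h (v - z) - h v‖ₑ ^ 2 := by
    refine lintegral_congr_ae ?_
    filter_upwards [Lp.coeFn_sub T h, Lp.coeFn_compMeasurePreserving h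
      (measurePreserving_sub_right volume z)] with v a1 a2
    rw [a1, Pi.sub_apply, a2]
    rfl
  rw [← e1, ← h3]
  refine lintegral_congr_ae ?_
  filter_upwards [Lp.coeFn_sub (𝓕 T) (𝓕 h), fourier_translate z h] with ξ a1 a2
  rw [a1, Pi.sub_apply, a2, ← mul_pow, ← enorm_mul, sub_mul, one_mul]

/-- Lower bound for the symbol of the Gagliardo seminorm, from the vectors `z` with
`z·ξ ∈ [1/4, 3/4]` in a ball of radius `1/(4|ξ|)`. -/
lemma exists_le_lintegral_phase {d : ℕ} {s : ℝ} (hs : 0 < s) :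
    ∃ c, 0 < c ∧ ∀ ξ : Vel d, ENNReal.ofReal (c * ‖ξ‖ ^ (2 * s)) ≤
      ∫⁻ z : Vel d, ENNReal.ofReal (‖z‖ ^ ((d : ℝ) + 2 * s))⁻¹ *
        ‖translationPhase z ξ - 1‖ₑ ^ 2 := by
  set V := (volume : Measure (Vel d)).real (Metric.ball 0 1) with hV
  have hVpos : 0 < V := by
    rw [hV, measureReal_def, ENNReal.toReal_pos_iff]
    exact ⟨Metric.measure_ball_pos _ _ one_pos, measure_ball_lt_top⟩
  set N := (d : ℝ) + 2 * s with hN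
  have hN0 : 0 < N := by positivity
  refine ⟨(1 / 4) ^ d * V, by positivity, fun ξ => ?_⟩
  rcases eq_or_ne ξ 0 with rfl | hξ
  · simp [Real.zero_rpow (by positivity : 2 * s ≠ 0)]
  have hn : 0 < ‖ξ‖ := norm_pos_iff.2 hξ
  set r := 1 / (4 * ‖ξ‖) with hr
  have hr0 : 0 < r := by positivity
  set x : Vel d := (1 / (2 * ‖ξ‖ ^ 2)) • ξ with hx
  have hxn : ‖x‖ = 1 / (2 * ‖ξ‖) := by
    rw [hx, norm_smul, Real.norm_of_nonneg (by positivity)]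
    field_simp
  have hxi : inner ℝ x ξ = 1 / 2 := by
    rw [hx, real_inner_smul_left, real_inner_self_eq_norm_sq]
    field_simp
  have key : ∀ z ∈ Metric.ball x r, ENNReal.ofReal (‖ξ‖ ^ N) ≤
      ENNReal.ofReal (‖z‖ ^ N)⁻¹ * ‖translationPhase z ξ - 1‖ₑ ^ 2 := by
    intro z hz
    rw [mem_ball_iff_norm] at hz
    have hzi : |inner ℝ z ξ - 1 / 2| ≤ 1 / 4 := by
      rw [← hxi, ← inner_sub_left]
      calc |inner ℝ (z - x) ξ| ≤ ‖z - x‖ * ‖ξ‖ := abs_real_inner_le_norm _ _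
        _ ≤ r * ‖ξ‖ := by gcongr
        _ = 1 / 4 := by rw [hr]; field_simp
    rw [abs_le] at hzi
    have hz0 : 0 < ‖z‖ := by
      rw [norm_pos_iff]
      rintro rfl
      rw [inner_zero_left] at hzi
      linarith [hzi.1]
    have hzn : ‖z‖ ≤ ‖ξ‖⁻¹ := by
      calc ‖z‖ = ‖(z - x) + x‖ := by congr 1; abel
        _ ≤ r + 1 / (2 * ‖ξ‖) := (norm_add_le _ _).trans (by rw [hxn]; gcongr)
        _ = 3 / 4 * ‖ξ‖⁻¹ := by rw [hr]; field_simp; norm_num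
        _ ≤ ‖ξ‖⁻¹ := by
          have : 0 < ‖ξ‖⁻¹ := by positivity
          linarith
    have hphase : 1 ≤ ‖translationPhase z ξ - 1‖ₑ ^ 2 := by
      have hre : (translationPhase z ξ).re ≤ 0 := by
        rw [translationPhase, Complex.exp_ofReal_mul_I_re, Real.cos_neg]
        refine Real.cos_nonpos_of_pi_div_two_le_of_le ?_ ?_ <;> nlinarith [Real.pi_pos]
      have h1 : 1 ≤ ‖translationPhase z ξ - 1‖ := by
        have := Complex.abs_re_le_norm (translationPhase z ξ - 1)
        rw [Complex.sub_re, Complex.one_re, abs_of_nonpos (by linarith)] at this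
        linarith
      refine one_le_pow₀ ?_
      rw [← ofReal_norm]
      exact ENNReal.one_le_ofReal.2 h1
    calc ENNReal.ofReal (‖ξ‖ ^ N) ≤ ENNReal.ofReal (‖z‖ ^ N)⁻¹ * 1 := by
          rw [mul_one]
          refine ENNReal.ofReal_le_ofReal ?_
          rw [← Real.inv_rpow hz0.le]
          gcongr
          rwa [le_inv_comm₀ hn hz0]
      _ ≤ _ := by gcongr
  calc ENNReal.ofReal ((1 / 4) ^ d * V * ‖ξ‖ ^ (2 * s))
      = ENNReal.ofReal (‖ξ‖ ^ N) * volume (Metric.ball x r) := by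
        rw [Measure.addHaar_ball_of_pos volume x hr0, finrank_euclideanSpace_fin,
          ← ENNReal.ofReal_toReal (measure_ball_lt_top (x := (0 : Vel d)) (r := 1)).ne,
          ← ENNReal.ofReal_mul (by positivity), ← ENNReal.ofReal_mul (by positivity),
          ← measureReal_def, ← hV]
        congr 1
        rw [hN, Real.rpow_add hn, Real.rpow_natCast, hr, div_pow, div_pow, mul_pow]
        field_simp
    _ = ∫⁻ z in Metric.ball x r, ENNReal.ofReal (‖ξ‖ ^ N) := by
        rw [setLIntegral_const]
    _ ≤ ∫⁻ z in Metric.ball x r, ENNReal.ofReal (‖z‖ ^ N)⁻¹ *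
          ‖translationPhase z ξ - 1‖ₑ ^ 2 := setLIntegral_mono' measurableSet_ball key
    _ ≤ _ := setLIntegral_le_lintegral _ _

/-- The homogeneous Sobolev seminorm is bounded by the Gagliardo seminorm. -/
theorem exists_homSobolevSq_le {d : ℕ} {s : ℝ} (hs : 0 < s) :
    ∃ C, 0 < C ∧ ∀ h : Lp ℂ 2 (volume : Measure (Vel d)), homSobolevSq s h ≤
      ENNReal.ofReal C * ∫⁻ v : Vel d, ∫⁻ w : Vel d,
        ENNReal.ofReal (‖v - w‖ ^ ((d : ℝ) + 2 * s))⁻¹ * ‖h v - h w‖ₑ ^ 2 := by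
  obtain ⟨c, hc, hle⟩ := exists_le_lintegral_phase (d := d) hs
  have hπ := Real.pi_pos
  set N := (d : ℝ) + 2 * s
  refine ⟨(2 * Real.pi) ^ (2 * s) / c, by positivity, fun h => ?_⟩
  let H : Vel d → ℂ := fun ξ => (𝓕 h : Lp ℂ 2 (volume : Measure (Vel d))) ξ
  have hHm : StronglyMeasurable H := Lp.stronglyMeasurable _
  have hhm : StronglyMeasurable h := Lp.stronglyMeasurable _
  have hphm : Measurable fun p : Vel d × Vel d => translationPhase p.1 p.2 :=
    continuous_translationPhase.measurable
  calc homSobolevSq s h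
      = ∫⁻ ξ : Vel d, ENNReal.ofReal ((2 * Real.pi) ^ (2 * s) / c) *
          (ENNReal.ofReal (c * ‖ξ‖ ^ (2 * s)) * ‖H ξ‖ₑ ^ 2) := by
        refine lintegral_congr fun ξ => ?_
        rw [← mul_assoc, ← ENNReal.ofReal_mul (by positivity),
          Real.mul_rpow (by positivity) (norm_nonneg _)]
        congr 2
        field_simp
    _ ≤ ∫⁻ ξ : Vel d, ENNReal.ofReal ((2 * Real.pi) ^ (2 * s) / c) *
          ∫⁻ z : Vel d, ENNReal.ofReal (‖z‖ ^ N)⁻¹ *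
            (‖translationPhase z ξ - 1‖ₑ ^ 2 * ‖H ξ‖ₑ ^ 2) := by
        refine lintegral_mono fun ξ => ?_
        gcongr
        simp_rw [← mul_assoc]
        rw [lintegral_mul_const' _ _ (ENNReal.pow_ne_top enorm_ne_top)]
        gcongr
        exact hle ξ
    _ = ENNReal.ofReal ((2 * Real.pi) ^ (2 * s) / c) * ∫⁻ z : Vel d, ∫⁻ ξ : Vel d,
          ENNReal.ofReal (‖z‖ ^ N)⁻¹ *
            (‖translationPhase z ξ - 1‖ₑ ^ 2 * ‖H ξ‖ₑ ^ 2) := by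
        have h0 : AEMeasurable (Function.uncurry fun ξ z : Vel d => ENNReal.ofReal (‖z‖ ^ N)⁻¹ *
            (‖translationPhase z ξ - 1‖ₑ ^ 2 * ‖H ξ‖ₑ ^ 2)) (volume.prod volume) := by
          have h1 : Measurable fun p : Vel d × Vel d => ‖translationPhase p.2 p.1 - 1‖ₑ ^ 2 :=
            ((hphm.comp measurable_swap).sub_const 1).enorm.pow_const 2
          have h2 : Measurable fun p : Vel d × Vel d => ‖H p.1‖ₑ ^ 2 :=
            (hHm.measurable.comp measurable_fst).enorm.pow_const 2
          have h4 : Measurable fun p : Vel d × Vel d => ENNReal.ofReal (‖p.2‖ ^ N)⁻¹ := by fun_prop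
          exact (h4.mul (h1.mul h2)).aemeasurable
        rw [lintegral_const_mul' _ _ ENNReal.ofReal_ne_top, lintegral_lintegral_swap h0]
    _ = ENNReal.ofReal ((2 * Real.pi) ^ (2 * s) / c) * ∫⁻ z : Vel d, ∫⁻ v : Vel d,
          ENNReal.ofReal (‖z‖ ^ N)⁻¹ * ‖h (v - z) - h v‖ₑ ^ 2 := by
        congr 1
        refine lintegral_congr fun z => ?_
        rw [lintegral_const_mul' _ _ ENNReal.ofReal_ne_top,
          lintegral_const_mul' _ _ ENNReal.ofReal_ne_top, lintegral_translate_sub_sq]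
    _ = _ := by
        congr 1
        have h0 : AEMeasurable (Function.uncurry fun z v : Vel d =>
            ENNReal.ofReal (‖z‖ ^ N)⁻¹ * ‖h (v - z) - h v‖ₑ ^ 2) (volume.prod volume) := by
          have h1 : Measurable fun p : Vel d × Vel d => h (p.2 - p.1) :=
            hhm.measurable.comp (measurable_snd.sub measurable_fst)
          have h2 : Measurable fun p : Vel d × Vel d => h p.2 := hhm.measurable.comp measurable_snd
          have h3 : Measurable fun p : Vel d × Vel d => ‖h (p.2 - p.1) - h p.2‖ₑ ^ 2 :=
            (h1.sub h2).enorm.pow_const 2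
          have h4 : Measurable fun p : Vel d × Vel d => ENNReal.ofReal (‖p.1‖ ^ N)⁻¹ := by fun_prop
          exact (h4.mul h3).aemeasurable
        rw [lintegral_lintegral_swap h0]
        refine lintegral_congr fun v => ?_
        rw [← lintegral_sub_left_eq_self (fun w => ENNReal.ofReal (‖v - w‖ ^ N)⁻¹ *
            ‖h v - h w‖ₑ ^ 2) v]
        refine lintegral_congr fun z => ?_
        rw [sub_sub_cancel, enorm_sub_rev]

/-! ### Fractional coercivity -/

lemma fracLapConst_pos {d : ℕ} (hd : 1 ≤ d) {α : ℝ} (hα₀ : 0 < α) (hα₂ : α < 2) :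
    0 < fracLapConst d α := by
  have hd0 : (0 : ℝ) < d := by exact_mod_cast hd
  have h1 : 0 < Real.Gamma ((d + α) / 2) := Real.Gamma_pos_of_pos (by positivity)
  have h2 : Real.Gamma (-α / 2) ≠ 0 := by
    refine Real.Gamma_ne_zero fun n hn => ?_
    have h3 : α = 2 * n := by linarith
    have h4 : (0 : ℝ) < n := by linarith
    have h5 : (1 : ℝ) ≤ n := by exact_mod_cast Nat.pos_of_ne_zero (by rintro rfl; simp at h4)
    linarith
  have := Real.pi_pos
  unfold fracLapConst
  positivity

section Weighted

variable {d : ℕ} {α : ℝ}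

lemma absolutelyContinuous_invWeight (hm : IsStableWeight d α (equilibrium d α)) :
    (volume : Measure (Vel d)) ≪ invWeight d α := by
  refine withDensity_absolutelyContinuous' ?_ (Eventually.of_forall fun v => ?_)
  · have := hm.continuous.measurable
    fun_prop
  · have := hm.pos v
    simpa using this

/-- The weighted `L²` norm, written with Lebesgue measure. -/
lemma eLpNorm_invWeight_sq {E : Type*} [NormedAddCommGroup E]
    (hm : IsStableWeight d α (equilibrium d α)) (u : Vel d → E) :
    eLpNorm u 2 (invWeight d α) ^ 2 = ∫⁻ v, ENNReal.ofReal (‖u v‖ ^ 2 / equilibrium d α v) := by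
  have hmm := hm.continuous.measurable
  rw [eLpNorm_two_sq, invWeight, lintegral_withDensity_eq_lintegral_mul_non_measurable _
    (by fun_prop) (Eventually.of_forall fun _ => ENNReal.ofReal_lt_top)]
  refine lintegral_congr fun v => ?_
  have := hm.pos v
  rw [Pi.mul_apply, ← ofReal_norm, ← ENNReal.ofReal_pow (norm_nonneg _),
    ← ENNReal.ofReal_mul (by positivity)]
  congr 1
  ring

lemma integrable_of_memLp_invWeight (hm : IsStableWeight d α (equilibrium d α)) (hα₀ : 0 < α)
    {f : Vel d → ℝ} (hf : MemLp f 2 (invWeight d α)) : Integrable f := by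
  have hfm : AEStronglyMeasurable f volume := hf.1.mono_ac (absolutelyContinuous_invWeight hm)
  have hmm := hm.continuous.measurable
  have h1 : Integrable fun v => f v ^ 2 / equilibrium d α v := by
    refine ⟨?_, ?_⟩
    · have := hfm.aemeasurable
      exact AEMeasurable.aestronglyMeasurable (by fun_prop)
    · rw [hasFiniteIntegral_iff_ofReal (Eventually.of_forall fun v =>
        div_nonneg (sq_nonneg _) (hm.pos v).le)]
      have h2 := eLpNorm_invWeight_sq hm f
      simp only [Real.norm_eq_abs, sq_abs] at h2
      rw [← h2]
      exact ENNReal.pow_lt_top hf.2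
  refine (h1.add (hm.integrable hα₀)).mono' hfm (Eventually.of_forall fun v => ?_)
  have hv := hm.pos v
  have e : |f v| * equilibrium d α v ≤ f v ^ 2 + equilibrium d α v ^ 2 := by
    nlinarith [sq_nonneg (|f v| - equilibrium d α v), sq_abs (f v), abs_nonneg (f v)]
  calc ‖f v‖ = |f v| * equilibrium d α v / equilibrium d α v := by
        rw [Real.norm_eq_abs]; field_simp
    _ ≤ (f v ^ 2 + equilibrium d α v ^ 2) / equilibrium d α v := by gcongr
    _ = _ := by simp only [Pi.add_apply]; field_simp

/-- An admissible coercivity constant exists. -/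
theorem exists_isCoercivityConst (hd : 1 ≤ d) (hα₀ : 0 < α) (hα₂ : α < 2) :
    ∃ C : ℝ, 0 < C ∧ IsCoercivityConst d α C := by
  have hm := isStableWeight_equilibrium hd hα₀ hα₂
  have hmm := hm.continuous.measurable
  obtain ⟨C₁, hC₁, hP⟩ := hm.exists_poincare hα₀
  obtain ⟨C₂, hC₂, hG⟩ := hm.exists_gagliardo_le hd hα₀ hα₂
  obtain ⟨C₃, hC₃, hS⟩ := exists_homSobolevSq_le (d := d) (s := α / 2) (by positivity)
  have hc : 0 < fracLapConst d α / 2 := by linarith [fracLapConst_pos hd hα₀ hα₂]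
  set c := fracLapConst d α / 2 with hcdef
  rw [show (d : ℝ) + 2 * (α / 2) = d + α by ring] at hS
  refine ⟨(C₁ + C₃ * (2 + C₂ * C₁)) / c, by positivity, fun f hf => ?_⟩
  have hfm : AEMeasurable f volume :=
    (hf.1.mono_ac (absolutelyContinuous_invWeight hm)).aemeasurable
  set μ := equilibrium d α with hμ
  set h : Vel d → ℝ := fun v => f v / μ v with hh
  have hhm : AEMeasurable h := hfm.div hmm.aemeasurable
  have hhf : ∀ v, h v * μ v = f v := fun v => div_mul_cancel₀ _ (hm.pos v).ne'
  have hhi : Integrable fun v => h v * μ v := by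
    simp_rw [hhf]; exact integrable_of_memLp_invWeight hm hα₀ hf
  set k : Vel d → ℝ := fun v => h v - ∫ w, h w * μ w with hk
  have hkm : AEMeasurable k := hhm.sub_const _
  have hD : dirichletForm ((d : ℝ) + α) μ k = dirichletForm ((d : ℝ) + α) μ h := by
    simp only [dirichletForm, hk, sub_sub_sub_cancel_right]
  set D := dirichletForm ((d : ℝ) + α) μ h with hDdef
  have hsym : symForm d α f = ENNReal.ofReal c * D := symForm_eq_dirichletForm d α f
  have hDle : ENNReal.ofReal ((C₁ + C₃ * (2 + C₂ * C₁)) / c) * symForm d α f =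
      ENNReal.ofReal (C₁ + C₃ * (2 + C₂ * C₁)) * D := by
    rw [hsym, ← mul_assoc, ← ENNReal.ofReal_mul (by positivity), div_mul_cancel₀ _ hc.ne']
  rw [hDle]
  by_cases hDtop : D = ⊤
  · rw [hDtop, ENNReal.mul_top (by simpa using by positivity)]
    exact le_top
  have hF : (fun v => (f v - proj d α f v) / √(μ v)) = fun v => k v * √(μ v) := by
    funext v
    have hv := hm.pos v
    have hs : 0 < √(μ v) := Real.sqrt_pos.2 hv
    have e : f v - proj d α f v = k v * (√(μ v) * √(μ v)) := by
      rw [Real.mul_self_sqrt hv.le, hk, sub_mul, hhf, proj]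
      simp_rw [hhf]
      rfl
    rw [e]
    field_simp
  rw [hF]
  have hFm : AEMeasurable fun v => k v * √(μ v) := by fun_prop
  have hL2 : eLpNorm (fun v => k v * √(μ v)) 2 volume ^ 2 ≤ ENNReal.ofReal C₁ * D := by
    rw [eLpNorm_two_sq]
    refine le_trans (le_of_eq (lintegral_congr fun v => ?_)) (hP h hhm hhi)
    rw [← ofReal_norm, ← ENNReal.ofReal_pow (norm_nonneg _), Real.norm_eq_abs, sq_abs, mul_pow,
      Real.sq_sqrt (hm.pos v).le]
  have hfin : eLpNorm (fun v => k v * √(μ v)) 2 volume < ⊤ := by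
    by_contra htop
    rw [not_lt, top_le_iff] at htop
    rw [htop, ENNReal.top_pow two_ne_zero, top_le_iff] at hL2
    exact (ENNReal.mul_lt_top ENNReal.ofReal_lt_top (lt_top_iff_ne_top.2 hDtop)).ne hL2
  have hmem : MemLp (fun v => ((k v * √(μ v) : ℝ) : ℂ)) 2 (volume : Measure (Vel d)) :=
    MemLp.ofReal ⟨hFm.aestronglyMeasurable, hfin⟩
  have hPk : ∫⁻ w, ENNReal.ofReal (k w ^ 2 * μ w) ≤ ENNReal.ofReal C₁ * D := hP h hhm hhi
  have hhom : homSobolevSq (α / 2) hmem.toLp ≤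
      ENNReal.ofReal C₃ * (ENNReal.ofReal 2 * D +
        ENNReal.ofReal C₂ * (ENNReal.ofReal C₁ * D)) := by
    refine (hS _).trans ?_
    gcongr
    refine le_trans (le_of_eq ?_) ((hG k hkm).trans ?_)
    · have hae := hmem.coeFn_toLp
      refine lintegral_congr_ae ?_
      filter_upwards [hae] with v hv
      refine lintegral_congr_ae ?_
      filter_upwards [hae] with w hw
      rw [hv, hw, ← Complex.ofReal_sub, ← ofReal_norm, Complex.norm_real,
        ← ENNReal.ofReal_pow (norm_nonneg _), Real.norm_eq_abs, sq_abs,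
        ← ENNReal.ofReal_mul (by positivity)]
      congr 1
      ring
    · rw [hD]
      gcongr
  rw [sobolevSq, dif_pos hmem]
  calc _ ≤ ENNReal.ofReal C₁ * D + ENNReal.ofReal C₃ * (ENNReal.ofReal 2 * D +
        ENNReal.ofReal C₂ * (ENNReal.ofReal C₁ * D)) := add_le_add hL2 hhom
    _ = _ := by
      rw [ENNReal.ofReal_add (by positivity) (by positivity), ENNReal.ofReal_mul hC₃.le,
        ENNReal.ofReal_add (by positivity) (by positivity), ENNReal.ofReal_mul hC₂.le]
      ring

end Weighted

/-! ### The gradient estimate -/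

/-- A smooth probability density supported in the ball of radius `t` and bounded by `P t^{-d}`. -/
structure IsMollifier {d : ℕ} (P t : ℝ) (ρ : Vel d → ℝ) : Prop where
  contDiff : ContDiff ℝ ∞ ρ
  hasCompactSupport : HasCompactSupport ρ
  nonneg : ∀ z, 0 ≤ ρ z
  integral_eq_one : ∫ z, ρ z = 1
  eq_zero : ∀ z, t < ‖z‖ → ρ z = 0
  fderiv_eq_zero : ∀ z, t < ‖z‖ → fderiv ℝ ρ z = 0
  le : ∀ z, ρ z ≤ P * t ^ (-(d : ℝ))

/-- Mollifiers at every scale, with the same constant. -/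
lemma exists_isMollifier (d : ℕ) :
    ∃ P : ℝ, 0 < P ∧ ∀ t, 0 < t → ∃ ρ : Vel d → ℝ, IsMollifier P t ρ := by
  set V := (volume : Measure (Vel d)).real (Metric.ball 0 1) with hV
  have hVpos : 0 < V := by
    rw [hV, measureReal_def, ENNReal.toReal_pos_iff]
    exact ⟨Metric.measure_ball_pos _ _ one_pos, measure_ball_lt_top⟩
  refine ⟨2 ^ d / V, by positivity, fun t ht => ?_⟩
  let φ : ContDiffBump (0 : Vel d) := ⟨t / 2, t, by positivity, by linarith⟩
  have hsupp : tsupport (φ.normed volume) = Metric.closedBall 0 t := φ.tsupport_normed_eq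
  refine ⟨φ.normed volume, φ.contDiff_normed, φ.hasCompactSupport_normed,
    fun z => φ.nonneg_normed z, φ.integral_normed, fun z hz => ?_, fun z hz => ?_, fun z => ?_⟩
  · exact image_eq_zero_of_notMem_tsupport (by rw [hsupp]; simpa using hz)
  · by_contra hne
    have := support_fderiv_subset ℝ (Function.mem_support.2 hne)
    rw [hsupp, mem_closedBall_zero_iff] at this
    linarith
  · refine (φ.normed_le_div_measure_closedBall_rIn volume z).trans (le_of_eq ?_)
    rw [Measure.addHaar_real_closedBall _ _ φ.rIn_pos.le, finrank_euclideanSpace_fin, ← hV,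
      Real.rpow_neg ht.le, Real.rpow_natCast, show φ.rIn = t / 2 from rfl, div_pow]
    field_simp

/-- Testing the weak gradient against a translated mollifier: `(∂ᵢf) * ρ = f * ∂ᵢρ`. -/
lemma HasWeakGradient.integral_mul_mollifier {d : ℕ} {f : Vel d → ℝ} {g : Vel d → Vel d}
    (h : HasWeakGradient f g) {ρ : Vel d → ℝ} (hρ : ContDiff ℝ ∞ ρ) (hc : HasCompactSupport ρ)
    (i : Fin d) (v : Vel d) :
    ∫ w, g w i * ρ (v - w) = ∫ w, f w * fderiv ℝ ρ (v - w) (EuclideanSpace.single i 1) := by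
  have hd : ∀ w, HasFDerivAt (fun w => ρ (v - w)) (-(fderiv ℝ ρ (v - w))) w := by
    intro w
    have h1 : HasFDerivAt ρ (fderiv ℝ ρ (v - w)) (v - w) :=
      (hρ.differentiable (by simp)).differentiableAt.hasFDerivAt
    have h2 : HasFDerivAt (fun w => ρ (v - w)) _ w :=
      h1.comp w ((hasFDerivAt_id w).const_sub v)
    exact h2.congr_fderiv (by ext x; simp)
  have key := h.2.2 (fun w => ρ (v - w)) (hρ.comp (contDiff_const.sub contDiff_id))
    (hc.comp_homeomorph (Homeomorph.subLeft v)) i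
  simp_rw [fun w => (hd w).fderiv, neg_apply, mul_neg] at key
  rw [integral_neg, neg_inj] at key
  exact key.symm

/-- The absolute value of the `i`-th partial derivative. -/
noncomputable def partialAbs {d : ℕ} (i : Fin d) (ρ : Vel d → ℝ) (z : Vel d) : ℝ :=
  |fderiv ℝ ρ z (EuclideanSpace.single i 1)|

namespace IsMollifier

variable {d : ℕ} {P t : ℝ} {ρ : Vel d → ℝ}

lemma integrable (h : IsMollifier P t ρ) : Integrable ρ :=
  h.contDiff.continuous.integrable_of_hasCompactSupport h.hasCompactSupport

lemma continuous_partialAbs (h : IsMollifier P t ρ) (i : Fin d) :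
    Continuous (partialAbs i ρ) :=
  ((h.contDiff.continuous_fderiv (by simp)).clm_apply continuous_const).abs

lemma integrable_partialAbs (h : IsMollifier P t ρ) (i : Fin d) :
    Integrable (partialAbs i ρ) := by
  refine (h.continuous_partialAbs i).integrable_of_hasCompactSupport ?_
  exact (h.hasCompactSupport.fderiv ℝ).comp_left
    (g := fun l : Vel d →L[ℝ] ℝ => |l (EuclideanSpace.single i 1)|) (by simp)

end IsMollifier

lemma locallyIntegrable_apply {d : ℕ} {g : Vel d → Vel d} (hg : LocallyIntegrable g) (i : Fin d) :
    LocallyIntegrable fun v => g v i := by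
  intro x
  obtain ⟨s, hs, hi⟩ := hg x
  exact ⟨s, hs, (EuclideanSpace.proj (𝕜 := ℝ) i).integrable_comp hi⟩

/-- The double integral of a sum of three kernels. -/
lemma lintegral_lintegral_add₃ {X : Type*} [MeasurableSpace X] {μ : Measure X} [SFinite μ]
    {F G H : X → X → ℝ≥0∞} (hF : AEMeasurable (Function.uncurry F) (μ.prod μ))
    (hG : AEMeasurable (Function.uncurry G) (μ.prod μ))
    (hH : AEMeasurable (Function.uncurry H) (μ.prod μ)) (a b c : ℝ≥0∞) :
    ∫⁻ v, ∫⁻ w, (a * F v w + b * G v w + c * H v w) ∂μ ∂μ =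
      a * (∫⁻ v, ∫⁻ w, F v w ∂μ ∂μ) + b * (∫⁻ v, ∫⁻ w, G v w ∂μ ∂μ) +
        c * ∫⁻ v, ∫⁻ w, H v w ∂μ ∂μ := by
  have hF' := hF.const_mul a
  have hG' := hG.const_mul b
  have hH' := hH.const_mul c
  have hall : AEMeasurable (Function.uncurry fun v w => a * F v w + b * G v w + c * H v w)
    (μ.prod μ) := (hF'.add hG').add hH'
  rw [lintegral_lintegral hall, lintegral_lintegral hF, lintegral_lintegral hG,
    lintegral_lintegral hH]
  have e1 := lintegral_add_left' (hF'.add hG') (fun z => c * Function.uncurry H z)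
  have e2 := lintegral_add_left' hF' (fun z => b * Function.uncurry G z)
  rw [lintegral_const_mul'' _ hF, lintegral_const_mul'' _ hG] at e2
  rw [lintegral_const_mul'' _ hH] at e1
  exact e1.trans (congrArg (· + _) e2)

/-- Convolution of a weighted function with a nonnegative kernel. -/
lemma lintegral_lintegral_mul_comp_sub {d : ℕ} {φ : Vel d → ℝ} {κ : Vel d → ℝ}
    (hφ : AEMeasurable φ) (hφ0 : ∀ v, 0 ≤ φ v) (hκ : Measurable κ) (hκi : Integrable κ)
    (hκ0 : ∀ z, 0 ≤ κ z) :
    ∫⁻ v : Vel d, ∫⁻ w : Vel d, ENNReal.ofReal (φ w * κ (v - w)) =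
      ENNReal.ofReal (∫ z, κ z) * ∫⁻ w, ENNReal.ofReal (φ w) := by
  have hm : AEMeasurable (Function.uncurry fun v w : Vel d => ENNReal.ofReal (φ w * κ (v - w)))
      (volume.prod volume) := by
    have h1 := hφ.comp_snd (μ := (volume : Measure (Vel d)))
    have h2 : Measurable fun p : Vel d × Vel d => κ (p.1 - p.2) :=
      hκ.comp (measurable_fst.sub measurable_snd)
    unfold Function.uncurry
    fun_prop
  rw [lintegral_lintegral_swap hm, ← lintegral_const_mul' _ _ ENNReal.ofReal_ne_top]
  refine lintegral_congr fun w => ?_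
  simp_rw [ENNReal.ofReal_mul (hφ0 w)]
  rw [lintegral_const_mul' _ _ ENNReal.ofReal_ne_top,
    lintegral_sub_right_eq_self (fun z => ENNReal.ofReal (κ z)) w,
    ← ofReal_integral_eq_lintegral_ofReal hκi (Eventually.of_forall hκ0), mul_comm]

namespace IsStableWeight

variable {d : ℕ} {α : ℝ} {m : Vel d → ℝ}

/-- The integrand of `∂ᵢf - (∂ᵢf) * ρ` in the weighted norm, split into a piece seen by the form
of `∂ᵢf` and a commutator with the weight. -/
lemma sub_sq_mul_mollifier_le (hm : IsStableWeight d α m) (hα₀ : 0 < α) {L : ℝ}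
    (hL : 0 < L) (hlip : ∀ v w, ‖v - w‖ ≤ 1 → |m v - m w| ≤ L * ‖v - w‖ * m w)
    {ρ : Vel d → ℝ} {P t : ℝ} (ht0 : 0 < t) (ht1 : t ≤ 1) (hP : 0 < P)
    (hρt : IsMollifier P t ρ) (u : Vel d → ℝ) (v w : Vel d) :
    2 / m v * ((u v - u w) ^ 2 * ρ (v - w)) ≤
      4 * P * t ^ α * ((u v / m v - u w / m w) ^ 2 / ‖v - w‖ ^ ((d : ℝ) + α) * m v) +
      4 * L ^ 2 * t ^ 2 * (u w ^ 2 / m w * ρ (v - w)) := by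
  have hv := hm.pos v
  have hw := hm.pos w
  have hρ := hρt.nonneg (v - w)
  have hR : 0 ≤ 4 * P * t ^ α * ((u v / m v - u w / m w) ^ 2 / ‖v - w‖ ^ ((d : ℝ) + α) * m v) +
      4 * L ^ 2 * t ^ 2 * (u w ^ 2 / m w * ρ (v - w)) := by positivity
  rcases lt_or_ge t ‖v - w‖ with hfar | hnear
  · rw [hρt.eq_zero _ hfar] at hR ⊢
    simpa using hR
  rcases eq_or_ne v w with rfl | hne
  · simpa using hR
  have h0 : 0 < ‖v - w‖ := norm_pos_iff.2 (sub_ne_zero.2 hne)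
  set x := u v / m v with hx
  set y := u w / m w with hy
  have hux : u v = x * m v := (div_mul_cancel₀ _ hv.ne').symm
  have huy : u w = y * m w := (div_mul_cancel₀ _ hw.ne').symm
  have h1 : (m v - m w) ^ 2 ≤ L ^ 2 * t ^ 2 * (m v * m w) := by
    have a1 : |m v - m w| ≤ L * t * m w := (hlip v w (hnear.trans ht1)).trans (by gcongr)
    have a2 : |m v - m w| ≤ L * t * m v := by
      rw [abs_sub_comm]
      refine (hlip w v (by rw [norm_sub_rev]; linarith)).trans ?_
      rw [norm_sub_rev]; gcongr
    calc (m v - m w) ^ 2 = |m v - m w| * |m v - m w| := by rw [← sq, sq_abs]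
      _ ≤ (L * t * m v) * (L * t * m w) := by gcongr
      _ = _ := by ring
  have h2 : (u v - u w) ^ 2 ≤ 2 * ((x - y) ^ 2 * m v ^ 2) + 2 * (y ^ 2 * (m v - m w) ^ 2) := by
    rw [hux, huy]
    nlinarith [sq_nonneg ((x - y) * m v - y * (m v - m w))]
  have h3 : ρ (v - w) ≤ P * t ^ α / ‖v - w‖ ^ ((d : ℝ) + α) := by
    calc ρ (v - w) ≤ P * t ^ (-(d : ℝ)) := hρt.le _
      _ = P * t ^ α / t ^ ((d : ℝ) + α) := by
        rw [Real.rpow_neg ht0.le, Real.rpow_add ht0]; field_simp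
      _ ≤ _ := by gcongr
  have h4 : u w ^ 2 / m w = y ^ 2 * m w := by rw [huy]; field_simp
  calc 2 / m v * ((u v - u w) ^ 2 * ρ (v - w))
      ≤ 2 / m v * ((2 * ((x - y) ^ 2 * m v ^ 2) +
          2 * (y ^ 2 * (L ^ 2 * t ^ 2 * (m v * m w)))) * ρ (v - w)) := by
        gcongr
        refine h2.trans ?_
        gcongr
    _ = 4 * ((x - y) ^ 2 * m v) * ρ (v - w) +
          4 * L ^ 2 * t ^ 2 * (y ^ 2 * m w * ρ (v - w)) := by
        field_simp; ring
    _ ≤ 4 * ((x - y) ^ 2 * m v) * (P * t ^ α / ‖v - w‖ ^ ((d : ℝ) + α)) +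
          4 * L ^ 2 * t ^ 2 * (y ^ 2 * m w * ρ (v - w)) := by gcongr
    _ = _ := by rw [h4]; ring

/-- Pointwise bound for `u = ∂ᵢf`, comparing it with its mollification `u * ρ = f * ∂ᵢρ`. -/
lemma ofReal_sq_div_le_lintegral (hm : IsStableWeight d α m) (hα₀ : 0 < α) {L : ℝ}
    (hL : 0 < L) (hlip : ∀ v w, ‖v - w‖ ≤ 1 → |m v - m w| ≤ L * ‖v - w‖ * m w)
    {ρ : Vel d → ℝ} {P t : ℝ} (ht0 : 0 < t) (ht1 : t ≤ 1) (hP : 0 < P)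
    (hρt : IsMollifier P t ρ) {f u : Vel d → ℝ} (hfm : AEMeasurable f)
    (hui : LocallyIntegrable u) (i : Fin d) (v : Vel d)
    (hconv : ∫ w, u w * ρ (v - w) = ∫ w, f w * fderiv ℝ ρ (v - w) (EuclideanSpace.single i 1))
    {M : ℝ} (hM0 : 0 < M) (hM : ∫ z, partialAbs i ρ z ≤ M) :
    ENNReal.ofReal (u v ^ 2 / m v) ≤
      ∫⁻ w, (ENNReal.ofReal (4 * P * t ^ α) * ENNReal.ofReal
          ((u v / m v - u w / m w) ^ 2 / ‖v - w‖ ^ ((d : ℝ) + α) * m v) +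
        ENNReal.ofReal (4 * L ^ 2 * t ^ 2) * ENNReal.ofReal (u w ^ 2 / m w * ρ (v - w)) +
        ENNReal.ofReal (2 * (1 + L) * M) *
          ENNReal.ofReal (f w ^ 2 / m w * partialAbs i ρ (v - w))) := by
  have hum : AEMeasurable u := hui.aestronglyMeasurable.aemeasurable
  have hρ'i := hρt.integrable_partialAbs i
  have hv := hm.pos v
  have hρvi : Integrable fun w => ρ (v - w) := hρt.integrable.comp_sub_left v
  have hρv1 : ∫ w, ρ (v - w) = 1 := by
    rw [integral_sub_left_eq_self ρ volume v, hρt.integral_eq_one]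
  have huρ : Integrable fun w => u w * ρ (v - w) := by
    refine hui.integrable_smul_right_of_hasCompactSupport (g := fun w => ρ (v - w))
      (hρt.contDiff.continuous.comp (continuous_const.sub continuous_id))
      (hρt.hasCompactSupport.comp_homeomorph (Homeomorph.subLeft v))
  set X := ∫ w, (u v - u w) * ρ (v - w) with hX
  set Y := ∫ w, f w * fderiv ℝ ρ (v - w) (EuclideanSpace.single i 1) with hY
  have hXY : u v = X + Y := by
    have e1 : X = u v - ∫ w, u w * ρ (v - w) := by
      rw [hX]
      simp_rw [sub_mul]
      rw [integral_sub (hρvi.const_mul _) huρ, integral_const_mul, hρv1, mul_one]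
    rw [e1, hconv]
    ring
  have hX2 : ENNReal.ofReal (X ^ 2) ≤ ∫⁻ w, ENNReal.ofReal ((u v - u w) ^ 2 * ρ (v - w)) := by
    have := ofReal_integral_mul_sq_le (hum.const_sub (u v)) hρvi
      (fun w => hρt.nonneg _) one_pos hρv1.le
    simpa using this
  have hY2 : ENNReal.ofReal (Y ^ 2) ≤
      ENNReal.ofReal M * ∫⁻ w, ENNReal.ofReal (f w ^ 2 * partialAbs i ρ (v - w)) := by
    have e1 : |Y| ≤ ∫ w, |f w| * partialAbs i ρ (v - w) := by
      refine (abs_integral_le_integral_abs).trans (le_of_eq ?_)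
      simp_rw [abs_mul, partialAbs]
    have e2 : Y ^ 2 ≤ (∫ w, |f w| * partialAbs i ρ (v - w)) ^ 2 := by
      rw [← sq_abs]; gcongr
    refine (ENNReal.ofReal_le_ofReal e2).trans ?_
    have := ofReal_integral_mul_sq_le (φ := fun w => |f w|) (κ := fun w => partialAbs i ρ (v - w))
      (μ := volume) hfm.abs (hρ'i.comp_sub_left v) (fun w => abs_nonneg _) hM0
      (by rw [integral_sub_left_eq_self (partialAbs i ρ) volume v]; exact hM)
    simpa using this
  have hsum : ENNReal.ofReal (u v ^ 2 / m v) ≤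
      ENNReal.ofReal (2 / m v) * ENNReal.ofReal (X ^ 2) +
      ENNReal.ofReal (2 / m v) * ENNReal.ofReal (Y ^ 2) := by
    rw [← ENNReal.ofReal_mul (by positivity), ← ENNReal.ofReal_mul (by positivity),
      ← ENNReal.ofReal_add (by positivity) (by positivity)]
    refine ENNReal.ofReal_le_ofReal ?_
    rw [← mul_add, div_mul_eq_mul_div]
    gcongr
    rw [hXY]
    nlinarith [sq_nonneg (X - Y)]
  have hmeas : AEMeasurable fun w => ENNReal.ofReal (2 / m v) *
      ENNReal.ofReal ((u v - u w) ^ 2 * ρ (v - w)) := by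
    exact ((((hum.const_sub (u v)).pow_const 2).mul
      hρvi.1.aemeasurable).ennreal_ofReal).const_mul _
  calc ENNReal.ofReal (u v ^ 2 / m v)
      ≤ ENNReal.ofReal (2 / m v) * (∫⁻ w, ENNReal.ofReal ((u v - u w) ^ 2 * ρ (v - w))) +
        ENNReal.ofReal (2 / m v) * (ENNReal.ofReal M *
          ∫⁻ w, ENNReal.ofReal (f w ^ 2 * partialAbs i ρ (v - w))) := by
        refine hsum.trans ?_
        gcongr
    _ = ∫⁻ w, (ENNReal.ofReal (2 / m v) * ENNReal.ofReal ((u v - u w) ^ 2 * ρ (v - w)) +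
        ENNReal.ofReal (2 / m v) * (ENNReal.ofReal M *
          ENNReal.ofReal (f w ^ 2 * partialAbs i ρ (v - w)))) := by
        rw [lintegral_add_left' hmeas, lintegral_const_mul' _ _ ENNReal.ofReal_ne_top,
          lintegral_const_mul' _ _ ENNReal.ofReal_ne_top,
          lintegral_const_mul' _ _ ENNReal.ofReal_ne_top]
    _ ≤ _ := by
        refine lintegral_mono fun w => ?_
        have hw := hm.pos w
        have hρv := hρt.nonneg (v - w)
        have hρv' : 0 ≤ partialAbs i ρ (v - w) := abs_nonneg _
        refine add_le_add ?_ ?_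
        · rw [← ENNReal.ofReal_mul (by positivity), ← ENNReal.ofReal_mul (by positivity),
            ← ENNReal.ofReal_mul (by positivity), ← ENNReal.ofReal_add (by positivity)
            (by positivity)]
          exact ENNReal.ofReal_le_ofReal
            (hm.sub_sq_mul_mollifier_le hα₀ hL hlip ht0 ht1 hP hρt u v w)
        · rw [← ENNReal.ofReal_mul (by positivity), ← ENNReal.ofReal_mul (by positivity),
            ← ENNReal.ofReal_mul (by positivity)]
          refine ENNReal.ofReal_le_ofReal ?_
          rcases lt_or_ge t ‖v - w‖ with hfar | hnear
          · have : partialAbs i ρ (v - w) = 0 := by simp [partialAbs, hρt.fderiv_eq_zero _ hfar]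
            simp [this]
          · -- `m w ≤ (1 + L) m v` at distance at most `t ≤ 1`
            have e1 : m w ≤ (1 + L) * m v := by
              have h1 := hlip w v (by rw [norm_sub_rev]; linarith)
              rw [norm_sub_rev] at h1
              have h2 : L * ‖v - w‖ * m v ≤ L * 1 * m v := by gcongr; linarith
              linarith [le_abs_self (m w - m v)]
            have e2 : 1 / m v ≤ (1 + L) / m w := by
              rw [div_le_div_iff₀ hv hw]; linarith
            calc 2 / m v * (M * (f w ^ 2 * partialAbs i ρ (v - w)))
                = 2 * M * (f w ^ 2 * partialAbs i ρ (v - w)) * (1 / m v) := by ring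
              _ ≤ 2 * M * (f w ^ 2 * partialAbs i ρ (v - w)) * ((1 + L) / m w) := by gcongr
              _ = _ := by ring

/-- The pointwise bound integrated in `v`. -/
lemma lintegral_sq_div_le (hm : IsStableWeight d α m) (hα₀ : 0 < α) {L : ℝ}
    (hL : 0 < L) (hlip : ∀ v w, ‖v - w‖ ≤ 1 → |m v - m w| ≤ L * ‖v - w‖ * m w)
    {ρ : Vel d → ℝ} {P t : ℝ} (ht0 : 0 < t) (ht1 : t ≤ 1) (hP : 0 < P)
    (hρt : IsMollifier P t ρ) {f u : Vel d → ℝ} (hfm : AEMeasurable f)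
    (hui : LocallyIntegrable u) (i : Fin d)
    (hconv : ∀ v, ∫ w, u w * ρ (v - w) =
      ∫ w, f w * fderiv ℝ ρ (v - w) (EuclideanSpace.single i 1))
    {M : ℝ} (hM0 : 0 < M) (hM : ∫ z, partialAbs i ρ z ≤ M) :
    ∫⁻ v, ENNReal.ofReal (u v ^ 2 / m v) ≤
      ENNReal.ofReal (4 * P * t ^ α) * dirichletForm ((d : ℝ) + α) m (fun v => u v / m v) +
      ENNReal.ofReal (4 * L ^ 2 * t ^ 2) * (∫⁻ v, ENNReal.ofReal (u v ^ 2 / m v)) +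
      ENNReal.ofReal (2 * (1 + L) * M) *
        (ENNReal.ofReal M * ∫⁻ v, ENNReal.ofReal (f v ^ 2 / m v)) := by
  have hmm := hm.continuous.measurable
  have hum : AEMeasurable u := hui.aestronglyMeasurable.aemeasurable
  have hρm := hρt.contDiff.continuous.measurable
  have hρ'm := (hρt.continuous_partialAbs i).measurable
  have hsub : Measurable fun p : Vel d × Vel d => p.1 - p.2 := measurable_fst.sub measurable_snd
  have huw : AEMeasurable fun w => u w ^ 2 / m w := (hum.pow_const 2).div hmm.aemeasurable
  have hfw : AEMeasurable fun w => f w ^ 2 / m w := (hfm.pow_const 2).div hmm.aemeasurable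
  have hF1 : AEMeasurable (Function.uncurry fun v w : Vel d => ENNReal.ofReal
      ((u v / m v - u w / m w) ^ 2 / ‖v - w‖ ^ ((d : ℝ) + α) * m v))
      ((volume : Measure (Vel d)).prod volume) :=
    (((aemeasurable_sub_sq (hum.div hmm.aemeasurable)).div
      (hsub.norm.pow_const _).aemeasurable).mul
        (hmm.comp measurable_fst).aemeasurable).ennreal_ofReal
  have hF2 : AEMeasurable (Function.uncurry fun v w : Vel d =>
      ENNReal.ofReal (u w ^ 2 / m w * ρ (v - w))) ((volume : Measure (Vel d)).prod volume) :=
    (huw.comp_snd.mul (hρm.comp hsub).aemeasurable).ennreal_ofReal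
  have hF3 : AEMeasurable (Function.uncurry fun v w : Vel d =>
      ENNReal.ofReal (f w ^ 2 / m w * partialAbs i ρ (v - w)))
      ((volume : Measure (Vel d)).prod volume) :=
    (hfw.comp_snd.mul (hρ'm.comp hsub).aemeasurable).ennreal_ofReal
  have hI2 := lintegral_lintegral_mul_comp_sub huw
    (fun w => div_nonneg (sq_nonneg _) (hm.pos w).le) hρm hρt.integrable hρt.nonneg
  rw [hρt.integral_eq_one, ENNReal.ofReal_one, one_mul] at hI2
  have hI3 := lintegral_lintegral_mul_comp_sub hfw
    (fun w => div_nonneg (sq_nonneg _) (hm.pos w).le) hρ'm (hρt.integrable_partialAbs i)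
    (fun z => abs_nonneg _)
  refine (lintegral_mono fun v => hm.ofReal_sq_div_le_lintegral hα₀ hL hlip ht0 ht1 hP hρt hfm
    hui i v (hconv v) hM0 hM).trans ?_
  rw [lintegral_lintegral_add₃ hF1 hF2 hF3, hI2, hI3, dirichletForm]
  gcongr

/-- A partial derivative is controlled by the function itself, up to a small multiple of its own
form: compare `∂ᵢf` with its mollification `f * ∂ᵢρ`. -/
theorem exists_gradient_bound (hm : IsStableWeight d α m) (hα₀ : 0 < α)
    {δ : ℝ} (hδ : 0 < δ) :
    ∃ K, 0 < K ∧ ∀ (f : Vel d → ℝ) (g : Vel d → Vel d), HasWeakGradient f g → ∀ i,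
      ∫⁻ v, ENNReal.ofReal (g v i ^ 2 / m v) ≤
        ENNReal.ofReal K * (∫⁻ v, ENNReal.ofReal (f v ^ 2 / m v)) +
        ENNReal.ofReal δ * dirichletForm ((d : ℝ) + α) m (fun v => g v i / m v) := by
  obtain ⟨L, hL, hlip⟩ := hm.exists_lipschitz
  obtain ⟨P, hP, hmoll⟩ := exists_isMollifier d
  have hmm := hm.continuous.measurable
  -- the scale: small enough both for the prefactor `δ` and for absorbing the commutator
  set t := min 1 (min (1 / (4 * L)) ((δ / (8 * P)) ^ α⁻¹)) with ht
  have ht0 : 0 < t := by positivity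
  have ht1 : t ≤ 1 := min_le_left _ _
  have htL : 4 * L ^ 2 * t ^ 2 ≤ 1 / 2 := by
    have h1 : t ≤ 1 / (4 * L) := (min_le_right _ _).trans (min_le_left _ _)
    have h2 : L * t ≤ 1 / 4 := by
      calc L * t ≤ L * (1 / (4 * L)) := by gcongr
        _ = 1 / 4 := by field_simp
    have h3 : 0 ≤ L * t := by positivity
    nlinarith
  have htδ : 2 * (4 * P * t ^ α) ≤ δ := by
    have h1 : t ≤ (δ / (8 * P)) ^ α⁻¹ := (min_le_right _ _).trans (min_le_right _ _)
    have h2 : t ^ α ≤ δ / (8 * P) := by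
      calc t ^ α ≤ ((δ / (8 * P)) ^ α⁻¹) ^ α := by gcongr
        _ = _ := Real.rpow_inv_rpow (by positivity) hα₀.ne'
    calc 2 * (4 * P * t ^ α) ≤ 2 * (4 * P * (δ / (8 * P))) := by gcongr
      _ = δ := by field_simp; norm_num
  obtain ⟨ρ, hρt⟩ := hmoll t ht0
  set M := 1 + ∑ i, ∫ z, partialAbs i ρ z with hM
  have hρ'nn : ∀ i, 0 ≤ ∫ z, partialAbs i ρ z := fun i => integral_nonneg fun z => abs_nonneg _
  have hMi : ∀ i, ∫ z, partialAbs i ρ z ≤ M := fun i => by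
    have := Finset.single_le_sum (fun j _ => hρ'nn j) (Finset.mem_univ i)
    linarith
  have hM0 : 0 < M := by
    have := Finset.sum_nonneg fun i (_ : i ∈ Finset.univ) => hρ'nn i
    linarith
  set a := 4 * P * t ^ α with ha
  set b := 4 * L ^ 2 * t ^ 2 with hb
  set c := 2 * (1 + L) * M with hc
  have ha0 : 0 < a := by positivity
  have hb0 : 0 < b := by positivity
  have hc0 : 0 < c := by positivity
  refine ⟨2 * (c * M), by positivity, fun f g hfg i => ?_⟩
  have hui := locallyIntegrable_apply hfg.2.1 i
  set u : Vel d → ℝ := fun v => g v i with hu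
  have hum : AEMeasurable u := hui.aestronglyMeasurable.aemeasurable
  have hfm : AEMeasurable f := hfg.1.aestronglyMeasurable.aemeasurable
  set D := dirichletForm ((d : ℝ) + α) m (fun v => u v / m v) with hD
  set A := ∫⁻ v, ENNReal.ofReal (u v ^ 2 / m v) with hA
  set B := ∫⁻ v, ENNReal.ofReal (f v ^ 2 / m v) with hB
  by_cases hDtop : D = ⊤
  · rw [hDtop, ENNReal.mul_top (by simpa using hδ)]
    simp
  have hAtop : A ≠ ⊤ := by
    have h1 := hm.lintegral_sq_lt_top hα₀ (hum.div hmm.aemeasurable) hDtop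
    refine (lt_of_le_of_lt (le_of_eq (lintegral_congr fun v => ?_)) h1).ne
    have hv := hm.pos v
    congr 1
    simp only [Pi.div_apply]
    field_simp
  have hmain : A ≤ ENNReal.ofReal a * D + ENNReal.ofReal b * A +
      ENNReal.ofReal c * (ENNReal.ofReal M * B) :=
    hm.lintegral_sq_div_le hα₀ hL hlip ht0 ht1 hP hρt hfm hui i
      (hfg.integral_mul_mollifier hρt.contDiff hρt.hasCompactSupport i) hM0 (hMi i)
  -- absorb the commutator term
  have hhalf : ENNReal.ofReal b * A ≤ 2⁻¹ * A := by
    gcongr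
    refine (ENNReal.ofReal_le_ofReal htL).trans (le_of_eq ?_)
    rw [one_div, ENNReal.ofReal_inv_of_pos two_pos]
    simp
  set R := ENNReal.ofReal a * D + ENNReal.ofReal c * (ENNReal.ofReal M * B) with hR
  have habs : 2⁻¹ * A ≤ R := by
    have h1 : 2⁻¹ * A + 2⁻¹ * A ≤ R + 2⁻¹ * A := by
      rw [← add_mul, ENNReal.inv_two_add_inv_two, one_mul]
      calc A ≤ _ := hmain
        _ ≤ ENNReal.ofReal a * D + 2⁻¹ * A + ENNReal.ofReal c * (ENNReal.ofReal M * B) := by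
          gcongr
        _ = _ := by rw [hR]; ring
    exact (ENNReal.add_le_add_iff_right (ENNReal.mul_ne_top (by simp) hAtop)).1 h1
  calc A = 2 * (2⁻¹ * A) := by
        rw [← mul_assoc, ENNReal.mul_inv_cancel two_ne_zero ENNReal.ofNat_ne_top, one_mul]
    _ ≤ ENNReal.ofReal 2 * R := by
        rw [ENNReal.ofReal_ofNat]
        gcongr
    _ = ENNReal.ofReal (2 * (c * M)) * B + ENNReal.ofReal (2 * a) * D := by
        rw [hR, ENNReal.ofReal_mul two_pos.le, ENNReal.ofReal_mul hc0.le,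
          ENNReal.ofReal_mul two_pos.le]
        ring
    _ ≤ _ := by gcongr

end IsStableWeight

/-- The weighted norm of `Πf` is the absolute value of the mass of `f`. -/
lemma eLpNorm_proj_sq {d : ℕ} {α : ℝ} (hm : IsStableWeight d α (equilibrium d α)) (hα₀ : 0 < α)
    (f : Vel d → ℝ) :
    eLpNorm (proj d α f) 2 (invWeight d α) ^ 2 = ENNReal.ofReal ((∫ w, f w) ^ 2) := by
  rw [eLpNorm_invWeight_sq hm]
  have h1 : ∀ v, ENNReal.ofReal (‖proj d α f v‖ ^ 2 / equilibrium d α v) =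
      ENNReal.ofReal ((∫ w, f w) ^ 2) * ENNReal.ofReal (equilibrium d α v) := fun v => by
    have hv := hm.pos v
    rw [← ENNReal.ofReal_mul (sq_nonneg _), Real.norm_eq_abs, sq_abs, proj]
    congr 1
    field_simp
  simp_rw [h1]
  rw [lintegral_const_mul' _ _ ENNReal.ofReal_ne_top,
    ← ofReal_integral_eq_lintegral_ofReal (hm.integrable hα₀)
      (Eventually.of_forall fun v => (hm.pos v).le), hm.integral_eq_one]
  simp

/-- The Poincaré inequality, written for `f = h μ` and with the mean restored. -/
lemma IsStableWeight.exists_lintegral_sq_div_le {d : ℕ} {α : ℝ} {m : Vel d → ℝ}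
    (hm : IsStableWeight d α m) (hα₀ : 0 < α) :
    ∃ C, 0 < C ∧ ∀ f : Vel d → ℝ, Integrable f →
      ∫⁻ v, ENNReal.ofReal (f v ^ 2 / m v) ≤
        ENNReal.ofReal C * dirichletForm ((d : ℝ) + α) m (fun v => f v / m v) +
        ENNReal.ofReal 2 * ENNReal.ofReal ((∫ w, f w) ^ 2) := by
  obtain ⟨C, hC, hP⟩ := hm.exists_poincare hα₀
  have hmm := hm.continuous.measurable
  refine ⟨2 * C, by positivity, fun f hf => ?_⟩
  have hfm := hf.1.aemeasurable
  have hhf : ∀ v, f v / m v * m v = f v := fun v => div_mul_cancel₀ _ (hm.pos v).ne'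
  have key := hP (fun v => f v / m v) (hfm.div hmm.aemeasurable) (by simpa only [hhf] using hf)
  simp only [hhf] at key
  set x := ∫ w, f w with hx
  have hpt : ∀ v, ENNReal.ofReal (f v ^ 2 / m v) ≤
      ENNReal.ofReal 2 * ENNReal.ofReal ((f v / m v - x) ^ 2 * m v) +
        ENNReal.ofReal (2 * x ^ 2) * ENNReal.ofReal (m v) := by
    intro v
    have hv := hm.pos v
    rw [← ENNReal.ofReal_mul two_pos.le, ← ENNReal.ofReal_mul (by positivity),
      ← ENNReal.ofReal_add (by positivity) (by positivity)]
    refine ENNReal.ofReal_le_ofReal ?_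
    have e : f v ^ 2 / m v = (f v / m v) ^ 2 * m v := by field_simp
    rw [e]
    nlinarith [mul_nonneg (sq_nonneg (f v / m v - 2 * x)) hv.le]
  calc ∫⁻ v, ENNReal.ofReal (f v ^ 2 / m v)
      ≤ ∫⁻ v, (ENNReal.ofReal 2 * ENNReal.ofReal ((f v / m v - x) ^ 2 * m v) +
        ENNReal.ofReal (2 * x ^ 2) * ENNReal.ofReal (m v)) := lintegral_mono hpt
    _ = ENNReal.ofReal 2 * (∫⁻ v, ENNReal.ofReal ((f v / m v - x) ^ 2 * m v)) +
        ENNReal.ofReal (2 * x ^ 2) := by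
      rw [lintegral_add_right _ (by fun_prop), lintegral_const_mul' _ _ ENNReal.ofReal_ne_top,
        lintegral_const_mul' _ _ ENNReal.ofReal_ne_top,
        ← ofReal_integral_eq_lintegral_ofReal (hm.integrable hα₀)
          (Eventually.of_forall fun v => (hm.pos v).le), hm.integral_eq_one]
      simp
    _ ≤ _ := by
      rw [ENNReal.ofReal_mul two_pos.le, ENNReal.ofReal_mul two_pos.le, mul_assoc]
      gcongr

/-- The weighted norm of a vector field, by components. -/
lemma eLpNorm_invWeight_sq_eq_sum {d : ℕ} {α : ℝ} (hm : IsStableWeight d α (equilibrium d α))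
    {g : Vel d → Vel d} (hg : LocallyIntegrable g) :
    eLpNorm g 2 (invWeight d α) ^ 2 =
      ∑ i, ∫⁻ v, ENNReal.ofReal (g v i ^ 2 / equilibrium d α v) := by
  have hmm := hm.continuous.measurable
  rw [eLpNorm_invWeight_sq hm, ← lintegral_finsetSum' _ fun i _ => ?_]
  · refine lintegral_congr fun v => ?_
    rw [← ENNReal.ofReal_sum_of_nonneg fun i _ => div_nonneg (sq_nonneg _) (hm.pos v).le,
      EuclideanSpace.real_norm_sq_eq, Finset.sum_div]
  · have hgi := (locallyIntegrable_apply hg i).aestronglyMeasurable.aemeasurable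
    exact ((hgi.pow_const 2).div hmm.aemeasurable).ennreal_ofReal

/-- The gradient estimate in terms of the symmetric form; no coercivity constant enters. -/
theorem exists_eLpNorm_weakGradient_le {d : ℕ} (hd : 1 ≤ d) {α : ℝ} (hα₀ : 0 < α) (hα₂ : α < 2)
    {δ : ℝ} (hδ : 0 < δ) :
    ∃ K : ℝ, 0 < K ∧ ∀ (f : Vel d → ℝ) (g : Vel d → Vel d),
      MemLp f 2 (invWeight d α) → HasWeakGradient f g →
      eLpNorm g 2 (invWeight d α) ^ 2 ≤
        ENNReal.ofReal K * (symForm d α f + eLpNorm (proj d α f) 2 (invWeight d α) ^ 2) +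
          ENNReal.ofReal δ * symFormVec d α g := by
  have hm := isStableWeight_equilibrium hd hα₀ hα₂
  have hc : 0 < fracLapConst d α / 2 := by linarith [fracLapConst_pos hd hα₀ hα₂]
  obtain ⟨C, hC, hP⟩ := hm.exists_lintegral_sq_div_le hα₀
  obtain ⟨K₀, hK₀, hgrad⟩ := hm.exists_gradient_bound hα₀ (mul_pos hδ hc)
  set c := fracLapConst d α / 2 with hcdef
  have hd0 : (0 : ℝ) < d := by exact_mod_cast hd
  set B := C / c + 2 with hB
  have hB0 : 0 < B := by positivity
  refine ⟨d * (K₀ * B), by positivity, fun f g hf hfg => ?_⟩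
  set S := symForm d α f + eLpNorm (proj d α f) 2 (invWeight d α) ^ 2 with hS
  have hfS : ∫⁻ v, ENNReal.ofReal (f v ^ 2 / equilibrium d α v) ≤ ENNReal.ofReal B * S := by
    refine (hP f (integrable_of_memLp_invWeight hm hα₀ hf)).trans ?_
    have e : ENNReal.ofReal C = ENNReal.ofReal (C / c) * ENNReal.ofReal c := by
      rw [← ENNReal.ofReal_mul (by positivity), div_mul_cancel₀ _ hc.ne']
    rw [← eLpNorm_proj_sq hm hα₀ f, e, mul_assoc, ← symForm_eq_dirichletForm, hS, mul_add]
    gcongr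
    · linarith
    · have : 0 ≤ C / c := by positivity
      linarith
  have hgi : ∀ i, ∫⁻ v, ENNReal.ofReal (g v i ^ 2 / equilibrium d α v) ≤
      ENNReal.ofReal (K₀ * B) * S + ENNReal.ofReal δ * symForm d α fun v => g v i := by
    intro i
    refine (hgrad f g hfg i).trans ?_
    rw [ENNReal.ofReal_mul hK₀.le, ENNReal.ofReal_mul hδ.le, symForm_eq_dirichletForm, mul_assoc,
      mul_assoc]
    gcongr
  rw [eLpNorm_invWeight_sq_eq_sum hm hfg.2.1]
  refine (Finset.sum_le_sum fun i _ => hgi i).trans (le_of_eq ?_)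
  rw [Finset.sum_add_distrib, Finset.sum_const, Finset.card_univ, Fintype.card_fin, nsmul_eq_mul,
    ← Finset.mul_sum, ← mul_assoc, symFormVec, ENNReal.ofReal_mul hd0.le, ENNReal.ofReal_natCast]

end LevyFokkerPlanck

theorem mainTheorem4 (d : ℕ) (hd : 1 ≤ d) (α : ℝ) (hα₀ : 0 < α) (hα₂ : α < 2) :
    (∃ C_F : ℝ, 0 < C_F ∧ LevyFokkerPlanck.IsCoercivityConst d α C_F) ∧
    ∀ C_F : ℝ, 0 < C_F → LevyFokkerPlanck.IsCoercivityConst d α C_F →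
      ∀ ε : ℝ, 0 < ε → ∃ K : ℝ, 0 < K ∧
        ∀ (f : LevyFokkerPlanck.Vel d → ℝ) (g : LevyFokkerPlanck.Vel d → LevyFokkerPlanck.Vel d),
          MemLp f 2 (LevyFokkerPlanck.invWeight d α) →
          LevyFokkerPlanck.HasWeakGradient f g →
          eLpNorm g 2 (LevyFokkerPlanck.invWeight d α) ^ 2 ≤
            ENNReal.ofReal K * (LevyFokkerPlanck.symForm d α f +
                eLpNorm (LevyFokkerPlanck.proj d α f) 2 (LevyFokkerPlanck.invWeight d α) ^ 2) +
              ENNReal.ofReal (ε * C_F) * LevyFokkerPlanck.symFormVec d α g :=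
  ⟨LevyFokkerPlanck.exists_isCoercivityConst hd hα₀ hα₂, fun _ hC _ _ hε =>
    LevyFokkerPlanck.exists_eLpNorm_weakGradient_le hd hα₀ hα₂ (mul_pos hε hC)⟩
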